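/- Let $\mathbb R^{n+1,1}$ be Lorentz space with inner product $(\cdot,\cdot)$, identify $S^n=\mathbb P(\mathcal L)$ with its projective light cone $\mathcal L=\{y:(y,y)=0\}$, and let $S^{n,1}=\{s:(s,s)=1\}$ parametrize the oriented hyperspheres $\{\langle y\rangle\in S^n:(y,s)=0\}$. An $m$-sphere is an $(m+1,1)$-plane of $\mathbb R^{n+1,1}$. For an immersion $x=\langle\xi\rangle$ of a manifold into $S^n$ put $x^{(1)}|_u:=\langle\xi(u)\rangle\oplus d_u\xi(T_u)$. Two immersions $x,\hat x$ of an $m$-manifold envelop an $m$-sphere congruence if there is a smooth family $C(u)$ of $m$-spheres with $x^{(1)}|_u\subset C(u)$ and $\hat x^{(1)}|_u\subset C(u)$ for all $u$. A unit normal field of $x$ is a section $t+x$ of $(x^{(1)})^\perp/x$ with $(t,t)=1$; it is parallel if $\nabla^\perp(t+x)=0$, that is, $dt$ takes values in $x^{(1)}$. An envelope of a smooth family $s:\Sigma^m\to S^{n,1}$ of hyperspheres is an immersed hypersurface $f:M^{n-1}\to S^n$ with a submersion $\pi:M\to\Sigma$ such that $f$ touches the hypersphere $s(\pi(p))$ at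 $f(p)$ for every $p\in M$, i.e. $s\circ\pi$ is a unit normal field of $f$; the fibres of $\pi$ are its spherical curvature leaves. An extended curvature leaf of $f$ is an immersion $j$ into $M$ whose tangent spaces are invariant under the shape operator of $f$; it is also identified with $f\circ j$. Everything is of class $C^\infty$; $\Sigma$ is a Hausdorff, second countable $m$-manifold. (1) Let $x,\hat x:\Sigma^m\to S^n$ be pointwise distinct immersions that envelop an $m$-sphere congruence, and let $t+x$ be a parallel unit normal field of $x$. Then there are a smooth $m$-parameter family $s:\Sigma\to S^{n,1}$ of hyperspheres with $s+x=t+x$, whose differential has spacelike images, an envelope $f:M^{n-1}\to S^n$, $\pi:M\to\Sigma$ of $s$ ($M$ Hausdorff and second countable) that maps each fibre $\pi^{-1}(u)$ into an $(n-m-1)$-sphere, and two sections $j,\hat\jmath:\Sigma\to M$ of $\pi$ that are extended curvature leaves of $f$, with $x=f\circ j$ and $\hat x=f\circ\hat\jmath$. (Here $s$ need not be an immersion; for instance it is constant if $t$ is the normal of a fixed hypersphere that contains $x$ and $\hat x$.) (2) Conversely, let $m<n-1$, let $s:\Sigma^m\to S^{n,1}$ be an $m$-parameter family of hyperspheres that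 is a spacelike immersion, and let $f:M^{n-1}\to S^n$, $\pi:M\to\Sigma$ be an envelope of $s$. Let $j,\hat\jmath:L^m\to M$ be two extended curvature leaves of $f$ that are complementary to the spherical curvature leaves (their tangent spaces are complementary to $\ker d\pi$), corresponding along these ($\pi\circ j=\pi\circ\hat\jmath$), with $f\circ j$ and $f\circ\hat\jmath$ pointwise distinct. Then $f\circ j$ and $f\circ\hat\jmath$ envelop a congruence of $m$-spheres. -/

import Mathlib

open Metric
open scoped Manifold ContDiff

universe u v w

noncomputable section

namespace ConformalSubmanifold

/-- The vector space underlying the Lorentz space `ℝ^{n+1,1}`: `n + 1` spacelike coordinates and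
one timelike coordinate. -/
abbrev LorentzSpace (n : ℕ) : Type := EuclideanSpace ℝ (Fin (n + 1)) × ℝ

/-- The Lorentz inner product `(v, w)` of `ℝ^{n+1,1}`. -/
def lorentz {n : ℕ} (v w : LorentzSpace n) : ℝ := inner ℝ v.1 w.1 - v.2 * w.2

/-- The `n`-sphere. -/
abbrev Sph (n : ℕ) : Type := sphere (0 : EuclideanSpace ℝ (Fin (n + 1))) 1

instance factFinrank (n : ℕ) :
    Fact (Module.finrank ℝ (EuclideanSpace ℝ (Fin (n + 1))) = n + 1) :=
  ⟨finrank_euclideanSpace_fin⟩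

/-- The identification `S^n ≅ ℙ(𝓛)` of the sphere with the projective light cone of `ℝ^{n+1,1}`:
the point `y` is the null line spanned by `(y, 1)`. -/
def light {n : ℕ} (y : Sph n) : LorentzSpace n := ((y : EuclideanSpace ℝ (Fin (n + 1))), 1)

section Maps

variable {k n : ℕ} {N : Type*} [TopologicalSpace N] [ChartedSpace (EuclideanSpace ℝ (Fin k)) N]

/-- The differential `d_p g` of a map `g` from a `k`-manifold into `ℝ^{n+1,1}`. -/
def vderiv (g : N → LorentzSpace n) (p : N) : TangentSpace (𝓡 k) p →ₗ[ℝ] LorentzSpace n :=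
  (mfderiv (𝓡 k) 𝓘(ℝ, LorentzSpace n) g p).toLinearMap

/-- `x` is a smooth immersion of a `k`-manifold into `S^n`. -/
def IsSphImmersion (x : N → Sph n) : Prop :=
  ContMDiff (𝓡 k) (𝓡 n) ∞ x ∧ ∀ p, Function.Injective (mfderiv (𝓡 k) (𝓡 n) x p)

/-- The derived subspace `x(p) ⊕ d_p ξ (T_p N)`, where `ξ` is a light cone lift of `x`; it does not
depend on the lift, and its projective light cone directions represent the tangent space of `x`. -/
def derived (x : N → Sph n) (p : N) : Submodule ℝ (LorentzSpace n) :=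
  Submodule.span ℝ {light (x p)} ⊔ LinearMap.range (vderiv (k := k) (fun q => light (x q)) p)

/-- `t` represents a unit normal field `t + x` of `x`, that is, a unit section of the (weightless)
normal bundle, with fibre the orthogonal complement of `derived x p` modulo the line `x(p)`. -/
structure IsUnitNormalField (x : N → Sph n) (t : N → LorentzSpace n) : Prop where
  smooth : ContMDiff (𝓡 k) 𝓘(ℝ, LorentzSpace n) ∞ t
  unit : ∀ p, lorentz (t p) (t p) = 1
  normal : ∀ p, ∀ v ∈ derived (k := k) x p, lorentz (t p) v = 0

/-- The normal connection `∇^⊥_X (t + x)`. The derivative of a normal field is orthogonal to `x`;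
its normal part is its class modulo `derived x p`, where the normal space
`(derived x p)^⊥ / x(p)` is identified with `x(p)^⊥ / derived x p` through the isometry of both
with the Riemannian normal space. The class does not change if a multiple of the lift of `x` is
added to `t`. -/
def normalDeriv (x : N → Sph n) (t : N → LorentzSpace n) (p : N) (X : TangentSpace (𝓡 k) p) :
    LorentzSpace n ⧸ derived (k := k) x p :=
  Submodule.Quotient.mk (vderiv t p X)

/-- `t + x` is a parallel unit normal field of `x`. -/
def IsParallelUnitNormalField (x : N → Sph n) (t : N → LorentzSpace n) : Prop :=
  IsUnitNormalField (k := k) x t ∧ ∀ (p : N) (X : TangentSpace (𝓡 k) p), normalDeriv x t p X = 0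

/-- An `r`-sphere in `S^n`, as an `(r+1,1)`-plane in `ℝ^{n+1,1}`: a subspace of dimension `r + 2`
of a Lorentz space has signature `(r+1,1)` if and only if it contains a timelike vector. -/
def IsSphere (r : ℕ) (C : Submodule ℝ (LorentzSpace n)) : Prop :=
  Module.finrank ℝ C = r + 2 ∧ ∃ v ∈ C, lorentz v v < 0

/-- `C` is a congruence (smooth family) of `k`-spheres, parametrized by a `k`-manifold: smoothness
means that it has smooth local frames. -/
def IsSphereCongruence (C : N → Submodule ℝ (LorentzSpace n)) : Prop :=
  (∀ p, IsSphere k (C p)) ∧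
    ∀ p₀ : N, ∃ U : Set N, IsOpen U ∧ p₀ ∈ U ∧ ∃ v : Fin (k + 2) → N → LorentzSpace n,
      (∀ i, ContMDiffOn (𝓡 k) 𝓘(ℝ, LorentzSpace n) ∞ (v i) U) ∧
        ∀ p ∈ U, C p = Submodule.span ℝ (Set.range fun i => v i p)

/-- The immersions `x` and `x'` of a `k`-manifold envelop a congruence of `k`-spheres: at every
parameter `p` the points `x p` and `x' p` lie on the `k`-sphere `C p`, and `x` and `x'` are
tangent to it there. -/
def EnvelopSphereCongruence (x x' : N → Sph n) : Prop :=
  ∃ C : N → Submodule ℝ (LorentzSpace n), IsSphereCongruence (k := k) C ∧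
    ∀ p, derived (k := k) x p ≤ C p ∧ derived (k := k) x' p ≤ C p

/-- A smooth family of (oriented) hyperspheres of `S^n`, as a map into the Lorentz sphere
`S^{n,1}`; the hypersphere of `s p` is the set of all `y` with `light y` orthogonal to `s p`. -/
def IsHypersphereFamily (s : N → LorentzSpace n) : Prop :=
  ContMDiff (𝓡 k) 𝓘(ℝ, LorentzSpace n) ∞ s ∧ ∀ p, lorentz (s p) (s p) = 1

/-- `s` is a spacelike immersion: the induced metric is positive definite. -/
def IsSpacelikeImmersion (s : N → LorentzSpace n) : Prop :=
  ∀ (p : N) (X : TangentSpace (𝓡 k) p), X ≠ 0 → 0 < lorentz (vderiv s p X) (vderiv s p X)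

/-- `A` is the shape operator at `p` of the hypersurface `f` with unit normal field `ν + f`:
`dν = - dφ ∘ A` modulo `f`, for the lift `φ` of `f`. (Adding a function multiple of `φ` to `ν`
changes `A` by a multiple of the identity, so that invariant subspaces do not change; for
`ν = (N, 0)` one gets the classical shape operator of `f` with respect to the unit normal field
`N`.) -/
def IsShapeOperator (f : N → Sph n) (ν : N → LorentzSpace n) (p : N)
    (A : TangentSpace (𝓡 k) p →ₗ[ℝ] TangentSpace (𝓡 k) p) : Prop :=
  ∀ Y : TangentSpace (𝓡 k) p,
    vderiv ν p Y + vderiv (fun q => light (f q)) p (A Y) ∈ Submodule.span ℝ {light (f p)}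

end Maps

section Envelopes

variable {m n : ℕ}
  {P : Type*} [TopologicalSpace P] [ChartedSpace (EuclideanSpace ℝ (Fin m)) P]
  {M : Type*} [TopologicalSpace M] [ChartedSpace (EuclideanSpace ℝ (Fin (n - 1))) M]
  {L : Type*} [TopologicalSpace L] [ChartedSpace (EuclideanSpace ℝ (Fin m)) L]

/-- The immersed hypersurface `f : M → S^n` is an envelope of the `m`-parameter family `s` of
hyperspheres: `M` is fibred over the parameter manifold by the submersion `π`, and `f` touches the
hypersphere `s (π p)` at the point `f p`, so that `s ∘ π` is a unit normal field of `f`. The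
fibres of `π` are the spherical curvature leaves: `f` maps the fibre over `u` into the sphere
given by the orthogonal complement of `s u` and the image of `d_u s`. -/
structure IsEnvelope (s : P → LorentzSpace n) (f : M → Sph n) (π : M → P) : Prop where
  immersion : IsSphImmersion (k := n - 1) f
  smooth_proj : ContMDiff (𝓡 (n - 1)) (𝓡 m) ∞ π
  submersion : ∀ p, Function.Surjective (mfderiv (𝓡 (n - 1)) (𝓡 m) π p)
  touch : IsUnitNormalField (k := n - 1) f (s ∘ π)

/-- `j` is an extended curvature leaf of the hypersurface `f` with unit normal field `ν + f`: an
immersed submanifold of `M` whose tangent spaces are invariant under the shape operator. -/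
structure IsExtendedCurvatureLeaf (f : M → Sph n) (ν : M → LorentzSpace n) (j : L → M) :
    Prop where
  smooth : ContMDiff (𝓡 m) (𝓡 (n - 1)) ∞ j
  immersion : ∀ u, Function.Injective (mfderiv (𝓡 m) (𝓡 (n - 1)) j u)
  invariant : ∀ u, ∃ A : TangentSpace (𝓡 (n - 1)) (j u) →ₗ[ℝ] TangentSpace (𝓡 (n - 1)) (j u),
    IsShapeOperator (k := n - 1) f ν (j u) A ∧
      ∀ X : TangentSpace (𝓡 m) u, ∃ Z : TangentSpace (𝓡 m) u,
        A (mfderiv (𝓡 m) (𝓡 (n - 1)) j u X) = mfderiv (𝓡 m) (𝓡 (n - 1)) j u Z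

/-- The leaf `j` is complementary to the fibres of `π`, that is, its tangent spaces are
complementary to those of the fibres. -/
def IsComplementaryLeaf (m n : ℕ) {P M L : Type*}
    [TopologicalSpace P] [ChartedSpace (EuclideanSpace ℝ (Fin m)) P]
    [TopologicalSpace M] [ChartedSpace (EuclideanSpace ℝ (Fin (n - 1))) M]
    [TopologicalSpace L] [ChartedSpace (EuclideanSpace ℝ (Fin m)) L]
    (π : M → P) (j : L → M) : Prop :=
  ∀ u : L, IsCompl
    (LinearMap.range (mfderiv (𝓡 m) (𝓡 (n - 1)) j u).toLinearMap)
    (LinearMap.ker (mfderiv (𝓡 (n - 1)) (𝓡 m) π (j u)).toLinearMap)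

end Envelopes

end ConformalSubmanifold

end

open ConformalSubmanifold

/-! (1) Let `C` be the enveloped congruence. Adding a multiple of `x` to `t` does not change the
normal field, and a unique multiple makes `s` orthogonal to `x'`. Since `C` is spanned by the
derived space of `x` and by `x'`, it follows that `s ⟂ C`. Parallelity puts `ds` into the derived
space of `x`, hence into `C`. Differentiating `(s, x') = 0` gives `ds ⟂ x'`, and the part of `C`
orthogonal to `x'` is the derived space of `x'`. So `ds` is tangent to both immersions
(`exists_isEnvelopedPair`). Being orthogonal to two distinct null lines, it is also spacelike
wherever it does not vanish.

Let `N = (C ⊕ s)^⊥`, a bundle of rank `n - 1 - m`. The null lines of `⟨x, x'⟩ ⊕ N` form an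
`(n-m-1)`-sphere orthogonal to `s` and `ds`. This defines the sphere even where `ds` degenerates. It
is parametrized over `N` by `v ↦ x + v - (v,v)/(2(x,x')) x'`, which misses only `x'`. A second copy
of `N`, with `x` and `x'` exchanged, covers `x'`; no gluing is needed, as `M` may be disconnected.
The zero sections of the copies are `x` and `x'`. The map is immersive there
(`IsEnvelopedPair.mfderiv_envelope_injective`), and `M` is the open set where it is immersive. As
`ds` is tangent to both zero sections, their tangent spaces are invariant under a shape operator
(`IsEnvelopedPair.exists_envelope`).

(2) On a complementary leaf, `ds = -dφ ∘ A` modulo `f`, and invariance under `A` puts the image of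
`ds` into the derived space of the leaf. By dimension this space is `f ∘ j` plus the image of `ds`.
Corresponding leaves share that image, so both derived spaces lie in `⟨f ∘ j, f ∘ j'⟩ ⊕ im ds`,
which has dimension `m + 2` (`envelopSphereCongruence_of_leaves`). -/

/-! ### Charts for the total space of a vector subbundle -/

section LinearBundle

variable {m k d : ℕ} {P : Type*} [TopologicalSpace P]
  [ChartedSpace (EuclideanSpace ℝ (Fin m)) P]
  {V : Type*} [NormedAddCommGroup V] [NormedSpace ℝ V]

/-- Two disjoint copies of the total space of a family of subspaces of a vector space. -/
abbrev DoubleTotal (N : P → Submodule ℝ V) : Type _ :=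
  {q : P × Bool × V // q.2.2 ∈ N q.1}

namespace DoubleTotal

/-- The base point. -/
def base {N : P → Submodule ℝ V} (q : DoubleTotal N) : P := q.1.1

/-- The label of the copy. -/
def label {N : P → Submodule ℝ V} (q : DoubleTotal N) : Bool := q.1.2.1

/-- The vector. -/
def vec {N : P → Submodule ℝ V} (q : DoubleTotal N) : V := q.1.2.2

end DoubleTotal

open DoubleTotal

/-- The family of subspaces is a smooth subbundle of rank `k`, given locally as the kernel of a
smooth family of surjections. -/
structure IsSmoothSubbundle (m k : ℕ) {P : Type*} [TopologicalSpace P]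
    [ChartedSpace (EuclideanSpace ℝ (Fin m)) P]
    {V : Type*} [NormedAddCommGroup V] [NormedSpace ℝ V] (N : P → Submodule ℝ V) : Prop where
  finrank_eq : ∀ u, Module.finrank ℝ (N u) = k
  kernel : ∀ u₀ : P, ∃ U : Set P, IsOpen U ∧ u₀ ∈ U ∧ ∃ (r : ℕ) (K : P → V →L[ℝ] (Fin r → ℝ)),
    ContMDiffOn (𝓡 m) 𝓘(ℝ, V →L[ℝ] (Fin r → ℝ)) ∞ K U ∧
    (∀ u ∈ U, ∀ w, w ∈ N u ↔ K u w = 0) ∧ Function.Surjective (K u₀)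

variable [FiniteDimensional ℝ V]

/-- The properties of a chart of the total space. -/
structure IsBundleChart (m d : ℕ) {P : Type*} [TopologicalSpace P]
    [ChartedSpace (EuclideanSpace ℝ (Fin m)) P]
    {V : Type*} [NormedAddCommGroup V] [NormedSpace ℝ V] {N : P → Submodule ℝ V}
    (c : OpenPartialHomeomorph (DoubleTotal N) (EuclideanSpace ℝ (Fin d))) : Prop where
  base_symm : ContMDiffOn (𝓡 d) (𝓡 m) ∞ (fun z => base (c.symm z)) c.target
  vec_symm : ContMDiffOn (𝓡 d) 𝓘(ℝ, V) ∞ (fun z => vec (c.symm z)) c.target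
  formula : ∃ (u₀ : P) (ι : EuclideanSpace ℝ (Fin m) →L[ℝ] EuclideanSpace ℝ (Fin d))
    (ρ : EuclideanSpace ℝ (Fin d) →L[ℝ] EuclideanSpace ℝ (Fin m))
    (Λ : V →L[ℝ] EuclideanSpace ℝ (Fin d)), Function.Surjective ρ ∧ ∀ q ∈ c.source,
      base q ∈ (chartAt (EuclideanSpace ℝ (Fin m)) u₀).source ∧
      c q = ι (chartAt (EuclideanSpace ℝ (Fin m)) u₀ (base q)) + Λ (vec q) ∧
      ρ (c q) = chartAt (EuclideanSpace ℝ (Fin m)) u₀ (base q)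

/-- A projection onto the kernel `S`, followed by coordinates of `S`, completes `K` to an
isomorphism. Invertibility persists under small changes of `K`, which is what trivializes the
subbundle near a point. -/
lemma exists_complementary_map {r : ℕ} (K : V →L[ℝ] (Fin r → ℝ)) (hK : Function.Surjective K)
    {S : Submodule ℝ V} (hS : ∀ w, w ∈ S ↔ K w = 0) (hk : Module.finrank ℝ S = k) :
    ∃ (L : V →L[ℝ] EuclideanSpace ℝ (Fin k))
      (D : V ≃L[ℝ] (Fin r → ℝ) × EuclideanSpace ℝ (Fin k)),
      (D : V →L[ℝ] (Fin r → ℝ) × EuclideanSpace ℝ (Fin k)) = K.prod L := by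
  obtain ⟨g, hg⟩ := LinearMap.exists_leftInverse_of_injective S.subtype (by simp)
  have e : S ≃ₗ[ℝ] EuclideanSpace ℝ (Fin k) := LinearEquiv.ofFinrankEq _ _ (by simp [hk])
  have hgx : ∀ x : S, g x = x := fun x => LinearMap.congr_fun hg x
  let L : V →ₗ[ℝ] EuclideanSpace ℝ (Fin k) := e.toLinearMap ∘ₗ g
  have hb : Function.Bijective (K.toLinearMap.prod L) := by
    constructor
    · rw [← LinearMap.ker_eq_bot, LinearMap.ker_eq_bot']
      intro x hx
      have h1 : K x = 0 := congrArg Prod.fst hx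
      have h2 : e (g x) = 0 := congrArg Prod.snd hx
      have h3 := hgx ⟨x, (hS x).2 h1⟩
      rw [LinearEquiv.map_eq_zero_iff] at h2
      simp only [h2] at h3
      exact (congrArg Subtype.val h3).symm
    · rintro ⟨a, b⟩
      obtain ⟨y, hy⟩ := hK a
      -- Adding an element of `S` corrects the second component without changing `K`.
      refine ⟨y + ((e.symm b - g y : S) : V), Prod.ext ?_ ?_⟩
      · change K (y + ((e.symm b - g y : S) : V)) = a
        rw [map_add, hy, (hS _).1 (e.symm b - g y).2, add_zero]
      · change e (g (y + ((e.symm b - g y : S) : V))) = b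
        rw [map_add, hgx]
        simp
  refine ⟨LinearMap.toContinuousLinearMap L,
    (LinearEquiv.ofBijective _ hb).toContinuousLinearEquiv, ?_⟩
  ext x <;> rfl

variable [IsManifold (𝓡 m) ∞ P] {N : P → Submodule ℝ V}

/-- With `D u = (K u, L)` invertible near the base point, the fibre over `u` is the preimage of `0 ×
ℝ^k` under `D u`. The chart is `(u, v) ↦ (a u, L v)`, with inverse built from the smooth family `(D
u)⁻¹`. -/
lemma exists_bundleChart (hN : IsSmoothSubbundle m k N) (hd : m + k = d) (p : DoubleTotal N) :
    ∃ c : OpenPartialHomeomorph (DoubleTotal N) (EuclideanSpace ℝ (Fin d)),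
      p ∈ c.source ∧ IsBundleChart m d c := by
  obtain ⟨U, hU, hpU, r, K, hKs, hKN, hKsurj⟩ := hN.kernel (base p)
  obtain ⟨L, D₀, hD₀⟩ := exists_complementary_map (k := k) (K (base p)) hKsurj
    (hKN _ hpU) (hN.finrank_eq _)
  let G := (Fin r → ℝ) × EuclideanSpace ℝ (Fin k)
  let D : P → V →L[ℝ] G := fun u => (K u).prod L
  have hDs : ContMDiffOn (𝓡 m) 𝓘(ℝ, V →L[ℝ] G) ∞ D U := by
    have h1 : ContDiff ℝ ∞ fun A : V →L[ℝ] (Fin r → ℝ) => A.prod L :=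
      ((ContinuousLinearMap.prodₗᵢ ℝ : ((V →L[ℝ] (Fin r → ℝ)) × (V →L[ℝ] EuclideanSpace ℝ (Fin k)))
        ≃ₗᵢ[ℝ] _).contDiff).comp (contDiff_id.prodMk contDiff_const)
    exact h1.contMDiff.comp_contMDiffOn hKs
  let a := chartAt (EuclideanSpace ℝ (Fin m)) (base p)
  let R : Set (V →L[ℝ] G) := Set.range ((↑) : (V ≃L[ℝ] G) → V →L[ℝ] G)
  have hR : IsOpen R := ContinuousLinearEquiv.isOpen
  -- The part of the chart domain over which `D u` is still invertible.
  let W : Set P := (U ∩ D ⁻¹' R) ∩ a.source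
  have hW : IsOpen W := (hDs.continuousOn.isOpen_inter_preimage hU hR).inter a.open_source
  have hpW : base p ∈ W := ⟨⟨hpU, ⟨D₀, hD₀⟩⟩, mem_chart_source _ _⟩
  have hinv : ContMDiffOn (𝓡 m) 𝓘(ℝ, G →L[ℝ] V) ∞ (fun u => (D u).inverse) W := by
    intro u hu
    obtain ⟨e, he⟩ := hu.1.2
    have h1 : ContDiffAt ℝ ∞ (ContinuousLinearMap.inverse : (V →L[ℝ] G) → G →L[ℝ] V) (D u) := by
      rw [← he]
      exact contDiffAt_map_inverse e
    exact h1.contMDiffAt.comp_contMDiffWithinAt u ((hDs u hu.1.1).mono fun y hy => hy.1.1)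
  let e : (EuclideanSpace ℝ (Fin m) × EuclideanSpace ℝ (Fin k)) ≃L[ℝ] EuclideanSpace ℝ (Fin d) :=
    ContinuousLinearEquiv.ofFinrankEq (by simp [hd])
  let ψ₁ : EuclideanSpace ℝ (Fin d) → P := fun z => a.symm (e.symm z).1
  let ψ₂ : EuclideanSpace ℝ (Fin d) → V := fun z => (D (ψ₁ z)).inverse (0, (e.symm z).2)
  let tgt : Set (EuclideanSpace ℝ (Fin d)) := {z | (e.symm z).1 ∈ a.target ∩ a.symm ⁻¹' W}
  have htgt : IsOpen tgt := by
    have := a.symm.isOpen_inter_preimage hW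
    exact this.preimage (continuous_fst.comp e.symm.continuous)
  have hψN : ∀ z ∈ tgt, ψ₂ z ∈ N (ψ₁ z) := by
    intro z hz
    obtain ⟨i, hi⟩ := hz.2.1.2
    rw [hKN _ hz.2.1.1]
    have h1 : D (ψ₁ z) (ψ₂ z) = (0, (e.symm z).2) := by
      simp only [ψ₂]
      change (D (a.symm (e.symm z).1)) ((D (a.symm (e.symm z).1)).inverse _) = _
      rw [← hi]; simp
    exact congrArg Prod.fst h1
  have hψ₁ : ContMDiffOn (𝓡 d) (𝓡 m) ∞ ψ₁ tgt := by
    have h1 : ContMDiff (𝓡 d) (𝓡 m) ∞ fun z : EuclideanSpace ℝ (Fin d) => (e.symm z).1 :=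
      (contDiff_fst.comp e.symm.contDiff).contMDiff
    exact (contMDiffOn_chart_symm (I := 𝓡 m) (n := ∞) (x := base p)).comp h1.contMDiffOn
      fun z hz => hz.1
  have hψ₂ : ContMDiffOn (𝓡 d) 𝓘(ℝ, V) ∞ ψ₂ tgt := by
    have h1 : ContMDiff (𝓡 d) 𝓘(ℝ, G) ∞
        fun z : EuclideanSpace ℝ (Fin d) => ((0, (e.symm z).2) : G) :=
      (contDiff_const.prodMk (contDiff_snd.comp e.symm.contDiff)).contMDiff
    exact (hinv.comp hψ₁ fun z hz => hz.2).clm_apply h1.contMDiffOn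
  classical
  let φ : DoubleTotal N → EuclideanSpace ℝ (Fin d) := fun q => e (a (base q), L (vec q))
  -- The value `p` off the target is only a default.
  let ψ : EuclideanSpace ℝ (Fin d) → DoubleTotal N := fun z =>
    if h : z ∈ tgt then ⟨(ψ₁ z, label p, ψ₂ z), hψN z h⟩ else p
  let src : Set (DoubleTotal N) := {q | base q ∈ W ∧ label q = label p}
  have hbase : Continuous (base : DoubleTotal N → P) := continuous_fst.comp continuous_subtype_val
  have hlabel : Continuous (label : DoubleTotal N → Bool) :=
    continuous_fst.comp (continuous_snd.comp continuous_subtype_val)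
  have hvec : Continuous (vec : DoubleTotal N → V) :=
    continuous_snd.comp (continuous_snd.comp continuous_subtype_val)
  have hsrc : IsOpen src :=
    (hW.preimage hbase).inter ((isOpen_discrete {label p}).preimage hlabel)
  have hφtgt : ∀ q ∈ src, φ q ∈ tgt := by
    intro q hq
    simp only [tgt, φ, Set.mem_ofPred_eq, ContinuousLinearEquiv.symm_apply_apply]
    exact ⟨a.map_source hq.1.2, by simpa [a.left_inv hq.1.2] using hq.1⟩
  have hψeq : ∀ z (h : z ∈ tgt), ψ z = ⟨(ψ₁ z, label p, ψ₂ z), hψN z h⟩ := fun z h => dif_pos h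
  let c : OpenPartialHomeomorph (DoubleTotal N) (EuclideanSpace ℝ (Fin d)) :=
    { toFun := φ
      invFun := ψ
      source := src
      target := tgt
      map_source' := hφtgt
      map_target' := by
        intro z hz
        rw [hψeq z hz]
        exact ⟨hz.2, rfl⟩
      left_inv' := by
        intro q hq
        rw [hψeq _ (hφtgt q hq)]
        have h1 : ψ₁ (φ q) = base q := by simp [ψ₁, φ, a.left_inv hq.1.2]
        have h2 : ψ₂ (φ q) = vec q := by
          simp only [ψ₂, h1]
          obtain ⟨i, hi⟩ := hq.1.1.2
          have h3 : ((0 : Fin r → ℝ), (e.symm (φ q)).2) = D (base q) (vec q) := by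
            have h4 : K (base q) (vec q) = 0 := (hKN _ hq.1.1.1 _).1 q.2
            have h5 : (e.symm (φ q)).2 = L (vec q) := by simp [φ]
            rw [h5]
            exact Prod.ext h4.symm rfl
          rw [h3, ← hi]
          simp
        apply Subtype.ext
        exact Prod.ext h1 (Prod.ext hq.2.symm h2)
      right_inv' := by
        intro z hz
        rw [hψeq z hz]
        have h1 : D (ψ₁ z) (ψ₂ z) = (0, (e.symm z).2) := by
          obtain ⟨i, hi⟩ := hz.2.1.2
          simp only [ψ₂]
          change (D (a.symm (e.symm z).1)) ((D (a.symm (e.symm z).1)).inverse _) = _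
          rw [← hi]; simp
        have h2 : L (ψ₂ z) = (e.symm z).2 := congrArg Prod.snd h1
        have h3 : a (ψ₁ z) = (e.symm z).1 := a.right_inv hz.1
        simp only [φ, base, vec, h2, h3]
        simp
      open_source := hsrc
      open_target := htgt
      continuousOn_toFun := by
        apply e.continuous.comp_continuousOn
        exact (a.continuousOn.comp hbase.continuousOn fun q hq => hq.1.2).prodMk
          (L.continuous.comp hvec).continuousOn
      continuousOn_invFun := by
        refine (show Topology.IsInducing (Subtype.val : DoubleTotal N → P × Bool × V) from
          ⟨rfl⟩).continuousOn_iff.2 ?_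
        have : ContinuousOn (fun z => (ψ₁ z, label p, ψ₂ z)) tgt :=
          hψ₁.continuousOn.prodMk (continuousOn_const.prodMk hψ₂.continuousOn)
        refine this.congr fun z hz => ?_
        simp [Function.comp, hψeq z hz] }
  refine ⟨c, ⟨hpW, rfl⟩, ⟨?_, ?_, ⟨base p,
    (e.toContinuousLinearMap).comp (ContinuousLinearMap.inl ℝ _ _),
    (ContinuousLinearMap.fst ℝ _ _).comp e.symm.toContinuousLinearMap,
    ((e.toContinuousLinearMap).comp (ContinuousLinearMap.inr ℝ _ _)).comp L,
    ?_, ?_⟩⟩⟩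
  · exact hψ₁.congr fun z hz => by
      change base (ψ z) = _
      rw [hψeq z hz]; rfl
  · exact hψ₂.congr fun z hz => by
      change vec (ψ z) = _
      rw [hψeq z hz]; rfl
  · exact Prod.fst_surjective.comp e.symm.surjective
  · intro q hq
    refine ⟨hq.1.2, ?_, ?_⟩
    · change e (a (base q), L (vec q)) = e (a (base q), 0) + e (0, L (vec q))
      rw [← map_add]; simp
    · change (e.symm (e (a (base q), L (vec q)))).1 = a (base q)
      simp

end LinearBundle

/-! ### The total space as a smooth manifold -/

section BundleManifold

open DoubleTotal

variable {m k d : ℕ} {P : Type*} [TopologicalSpace P]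
  [ChartedSpace (EuclideanSpace ℝ (Fin m)) P] [IsManifold (𝓡 m) ∞ P]
  {V : Type*} [NormedAddCommGroup V] [NormedSpace ℝ V]
  {N : P → Submodule ℝ V}

/-- The charted space structure of the total space of a smooth subbundle. -/
@[reducible] noncomputable def DoubleTotal.chartedSpace [FiniteDimensional ℝ V] (hN : IsSmoothSubbundle m k N)
    (hd : ∀ _ : P, m + k = d) : ChartedSpace (EuclideanSpace ℝ (Fin d)) (DoubleTotal N) where
  atlas := {c | IsBundleChart m d c}
  chartAt p := (exists_bundleChart hN (hd (base p)) p).choose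
  mem_chart_source p := (exists_bundleChart hN (hd (base p)) p).choose_spec.1
  chart_mem_atlas p := (exists_bundleChart hN (hd (base p)) p).choose_spec.2

variable [ChartedSpace (EuclideanSpace ℝ (Fin d)) (DoubleTotal N)]
  (hat : ∀ c ∈ atlas (EuclideanSpace ℝ (Fin d)) (DoubleTotal N), IsBundleChart m d c)

include hat

/-- A forward chart is a smooth expression in `base` and `vec`, and both are smooth along an inverse
chart; hence transition maps are smooth. -/
lemma DoubleTotal.isManifold : IsManifold (𝓡 d) ∞ (DoubleTotal N) := by
  refine isManifold_of_contDiffOn _ _ _ fun c c' hc hc' => ?_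
  obtain ⟨u₀, ι, ρ, Λ, -, h⟩ := (hat c' hc').formula
  have h1 := (hat c hc).base_symm
  have h2 := (hat c hc).vec_symm
  rw [← contMDiffOn_iff_contDiffOn]
  have hsub : ∀ z ∈ (𝓡 d).symm ⁻¹' (c.symm ≫ₕ c').source ∩ Set.range (𝓡 d),
      z ∈ c.target ∧ c.symm z ∈ c'.source := by
    intro z hz
    have := hz.1
    simpa using this
  have h3 : ContMDiffOn (𝓡 d) 𝓘(ℝ, EuclideanSpace ℝ (Fin d)) ∞
      (fun z => ι (chartAt (EuclideanSpace ℝ (Fin m)) u₀ (base (c.symm z))) + Λ (vec (c.symm z)))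
      ((𝓡 d).symm ⁻¹' (c.symm ≫ₕ c').source ∩ Set.range (𝓡 d)) := by
    refine ContMDiffOn.add ?_ ?_
    · refine ι.contMDiff.comp_contMDiffOn ?_
      exact (contMDiffOn_chart (I := 𝓡 m) (n := ∞) (x := u₀)).comp
        (h1.mono fun z hz => (hsub z hz).1) fun z hz => (h _ (hsub z hz).2).1
    · exact Λ.contMDiff.comp_contMDiffOn (h2.mono fun z hz => (hsub z hz).1)
  refine h3.congr fun z hz => ?_
  exact (h _ (hsub z hz).2).2.1

lemma DoubleTotal.contMDiff_base : ContMDiff (𝓡 d) (𝓡 m) ∞ (base : DoubleTotal N → P) := by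
  have := isManifold hat
  intro p
  let c := chartAt (EuclideanSpace ℝ (Fin d)) p
  have hc := hat c (chart_mem_atlas _ p)
  have h1 : ContMDiffOn (𝓡 d) (𝓡 m) ∞ (fun q => base (c.symm (c q))) c.source :=
    hc.base_symm.comp (contMDiffOn_chart (I := 𝓡 d)) fun q hq => c.map_source hq
  refine ((h1.congr fun q hq => ?_).contMDiffAt (c.open_source.mem_nhds (mem_chart_source _ p)))
  rw [c.left_inv hq]

lemma DoubleTotal.contMDiff_vec : ContMDiff (𝓡 d) 𝓘(ℝ, V) ∞ (vec : DoubleTotal N → V) := by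
  have := isManifold hat
  intro p
  let c := chartAt (EuclideanSpace ℝ (Fin d)) p
  have hc := hat c (chart_mem_atlas _ p)
  have h1 : ContMDiffOn (𝓡 d) 𝓘(ℝ, V) ∞ (fun q => vec (c.symm (c q))) c.source :=
    hc.vec_symm.comp (contMDiffOn_chart (I := 𝓡 d)) fun q hq => c.map_source hq
  refine ((h1.congr fun q hq => ?_).contMDiffAt (c.open_source.mem_nhds (mem_chart_source _ p)))
  rw [c.left_inv hq]

lemma DoubleTotal.contMDiff_of {l : ℕ} {Y : Type*} [TopologicalSpace Y]
    [ChartedSpace (EuclideanSpace ℝ (Fin l)) Y] {g : Y → DoubleTotal N}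
    (h₁ : ContMDiff (𝓡 l) (𝓡 m) ∞ fun y => base (g y)) (h₂ : Continuous fun y => label (g y))
    (h₃ : ContMDiff (𝓡 l) 𝓘(ℝ, V) ∞ fun y => vec (g y)) : ContMDiff (𝓡 l) (𝓡 d) ∞ g := by
  have hg : Continuous g := by
    refine continuous_induced_rng.2 ?_
    exact h₁.continuous.prodMk (h₂.prodMk h₃.continuous)
  intro y
  rw [contMDiffAt_iff_target]
  refine ⟨hg.continuousAt, ?_⟩
  let c := chartAt (EuclideanSpace ℝ (Fin d)) (g y)
  obtain ⟨u₀, ι, ρ, Λ, -, h⟩ := (hat c (chart_mem_atlas _ (g y))).formula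
  have hU : IsOpen (g ⁻¹' c.source) := c.open_source.preimage hg
  have h4 : ContMDiffOn (𝓡 l) 𝓘(ℝ, EuclideanSpace ℝ (Fin d)) ∞
      (fun z => ι (chartAt (EuclideanSpace ℝ (Fin m)) u₀ (base (g z))) + Λ (vec (g z)))
      (g ⁻¹' c.source) := by
    refine ContMDiffOn.add ?_ (Λ.contMDiff.comp_contMDiffOn h₃.contMDiffOn)
    refine ι.contMDiff.comp_contMDiffOn ?_
    exact (contMDiffOn_chart (I := 𝓡 m) (n := ∞) (x := u₀)).comp
      h₁.contMDiffOn fun z hz => (h _ hz).1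
  have h5 := h4.congr (f₁ := c ∘ g) fun z hz => (h _ hz).2.1
  exact h5.contMDiffAt (hU.mem_nhds (mem_chart_source _ (g y)))

/-- In charts `base` is the linear surjection `ρ`. -/
lemma DoubleTotal.mfderiv_base_surjective (p : DoubleTotal N) :
    Function.Surjective (mfderiv (𝓡 d) (𝓡 m) (base : DoubleTotal N → P) p) := by
  have := isManifold hat
  let c := chartAt (EuclideanSpace ℝ (Fin d)) p
  obtain ⟨u₀, ι, ρ, Λ, hρ, h⟩ := (hat c (chart_mem_atlas _ p)).formula
  let a := chartAt (EuclideanSpace ℝ (Fin m)) u₀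
  have hp : p ∈ c.source := mem_chart_source _ p
  have hcd : MDifferentiableAt (𝓡 d) (𝓡 d) c p := mdifferentiableAt_atlas (chart_mem_atlas _ p) hp
  have had : MDifferentiableAt (𝓡 m) (𝓡 m) a (base p) :=
    mdifferentiableAt_atlas (chart_mem_atlas _ u₀) (h p hp).1
  have hbd : MDifferentiableAt (𝓡 d) (𝓡 m) (base : DoubleTotal N → P) p :=
    (contMDiff_base hat p).mdifferentiableAt (by simp)
  have e1 : mfderiv (𝓡 d) (𝓡 m) (a ∘ base) p = (mfderiv (𝓡 m) (𝓡 m) a (base p)).comp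
      (mfderiv (𝓡 d) (𝓡 m) base p) := mfderiv_comp p had hbd
  have e2 : mfderiv (𝓡 d) (𝓡 m) (ρ ∘ c) p = (mfderiv (𝓡 d) (𝓡 m) ρ (c p)).comp
      (mfderiv (𝓡 d) (𝓡 d) c p) := mfderiv_comp p ρ.mdifferentiableAt hcd
  have e3 : (ρ ∘ c) =ᶠ[nhds p] (a ∘ base) :=
    Filter.eventually_of_mem (c.open_source.mem_nhds hp) fun q hq => (h q hq).2.2
  rw [e3.mfderiv_eq, e1] at e2
  have hc := (mdifferentiable_of_mem_atlas (I := 𝓡 d) (chart_mem_atlas _ p)).mfderiv_surjective hp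
  have ha := (mdifferentiable_of_mem_atlas (I := 𝓡 m)
    (chart_mem_atlas _ u₀)).mfderiv_injective (h p hp).1
  have hρ' : Function.Surjective (mfderiv (𝓡 d) (𝓡 m) ρ (c p)) := by
    rw [ContinuousLinearMap.mfderiv_eq]
    exact hρ
  intro X
  obtain ⟨Z, hZ⟩ := (hρ'.comp hc) (mfderiv (𝓡 m) (𝓡 m) a (base p) X)
  refine ⟨Z, ha ?_⟩
  rw [← hZ]
  exact DFunLike.congr_fun e2 Z

/-- The map `(base, vec)` is an immersion, because the chart factors through it. -/
lemma DoubleTotal.eq_zero_of_mfderiv_eq_zero (p : DoubleTotal N) (Y : TangentSpace (𝓡 d) p)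
    (h₁ : mfderiv (𝓡 d) (𝓡 m) (base : DoubleTotal N → P) p Y = 0)
    (h₂ : mfderiv (𝓡 d) 𝓘(ℝ, V) (vec : DoubleTotal N → V) p Y = 0) : Y = 0 := by
  have := isManifold hat
  let c := chartAt (EuclideanSpace ℝ (Fin d)) p
  obtain ⟨u₀, ι, ρ, Λ, hρ, h⟩ := (hat c (chart_mem_atlas _ p)).formula
  let a := chartAt (EuclideanSpace ℝ (Fin m)) u₀
  have hp : p ∈ c.source := mem_chart_source _ p
  have had : MDifferentiableAt (𝓡 m) (𝓡 m) a (base p) :=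
    mdifferentiableAt_atlas (chart_mem_atlas _ u₀) (h p hp).1
  have hbd : MDifferentiableAt (𝓡 d) (𝓡 m) (base : DoubleTotal N → P) p :=
    (contMDiff_base hat p).mdifferentiableAt (by simp)
  have hvd : MDifferentiableAt (𝓡 d) 𝓘(ℝ, V) (vec : DoubleTotal N → V) p :=
    (contMDiff_vec hat p).mdifferentiableAt (by simp)
  have e3 : c =ᶠ[nhds p] ((ι ∘ (a ∘ base)) + Λ ∘ vec) :=
    Filter.eventually_of_mem (c.open_source.mem_nhds hp) fun q hq => (h q hq).2.1
  have hc := (mdifferentiable_of_mem_atlas (I := 𝓡 d) (chart_mem_atlas _ p)).mfderiv_injective hp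
  have H1 := (had.hasMFDerivAt.comp p hbd.hasMFDerivAt)
  have H2 := (ι.hasMFDerivAt (x := (a ∘ base) p)).comp p H1
  have H3 := (Λ.hasMFDerivAt (x := vec p)).comp p hvd.hasMFDerivAt
  have H4 := (H2.add H3).congr_of_eventuallyEq e3
  apply hc
  have H5 := H4.mfderiv
  rw [map_zero]
  change mfderiv (𝓡 d) (𝓡 d) c p Y = 0
  have H6 : mfderiv (𝓡 d) (𝓡 d) c p Y = _ := DFunLike.congr_fun H5 Y
  rw [H6]
  change ι (mfderiv (𝓡 m) (𝓡 m) a (base p) (mfderiv (𝓡 d) (𝓡 m) base p Y)) +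
    Λ (mfderiv (𝓡 d) 𝓘(ℝ, V) vec p Y) = 0
  rw [h₁, h₂]
  exact (congrArg₂ (· + ·) ((congrArg ι (map_zero _)).trans (map_zero ι)) (map_zero Λ)).trans
    (add_zero _)

end BundleManifold

/-! ### Open submanifolds and the immersion locus -/

section OpenSubmanifold

variable {d : ℕ} {M : Type*} [TopologicalSpace M] [ChartedSpace (EuclideanSpace ℝ (Fin d)) M]
  [IsManifold (𝓡 d) ∞ M]

lemma mfderiv_opens_val_bijective (O : TopologicalSpace.Opens M) (p : O) :
    Function.Bijective (mfderiv (𝓡 d) (𝓡 d) (Subtype.val : O → M) p) := by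
  let c := chartAt (EuclideanSpace ℝ (Fin d)) p.1
  have hv : MDifferentiableAt (𝓡 d) (𝓡 d) (Subtype.val : O → M) p :=
    ((contMDiff_subtype_val (I := 𝓡 d) (n := ∞)) p).mdifferentiableAt (by simp)
  have hc : MDifferentiableAt (𝓡 d) (𝓡 d) c p.1 :=
    mdifferentiableAt_atlas (chart_mem_atlas _ _) (mem_chart_source _ _)
  have e1 : mfderiv (𝓡 d) (𝓡 d) (c ∘ Subtype.val) p = (mfderiv (𝓡 d) (𝓡 d) c p.1).comp
      (mfderiv (𝓡 d) (𝓡 d) Subtype.val p) := mfderiv_comp p hc hv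
  have h1 : Function.Bijective (mfderiv (𝓡 d) (𝓡 d) (c ∘ Subtype.val) p) :=
    (mdifferentiable_of_mem_atlas (I := 𝓡 d) (chart_mem_atlas _ p)).mfderiv_bijective
      (mem_chart_source _ p)
  have h2 := (mdifferentiable_of_mem_atlas (I := 𝓡 d) (chart_mem_atlas _ p.1)).mfderiv_bijective
      (mem_chart_source _ p.1)
  rw [e1] at h1
  exact (Function.Bijective.of_comp_iff' h2 _).1 h1

/-- Read in tangent coordinates at `p`, the differential is a continuous family of linear maps
between fixed spaces, where injectivity is an open condition. The coordinate changes are invertible,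
so they do not affect injectivity. -/
lemma isOpen_injective_mfderiv {E H : Type*} [NormedAddCommGroup E] [NormedSpace ℝ E]
    [TopologicalSpace H] {I : ModelWithCorners ℝ E H} {M' : Type*} [TopologicalSpace M']
    [ChartedSpace H M'] [IsManifold I ∞ M'] {f : M → M'} (hf : ContMDiff (𝓡 d) I ∞ f) :
    IsOpen {p | Function.Injective (mfderiv (𝓡 d) I f p)} := by
  rw [isOpen_iff_mem_nhds]
  intro p hp
  have h1 : ContinuousAt (inTangentCoordinates (𝓡 d) I id f (mfderiv (𝓡 d) I f) p) p :=
    ((hf p).mfderiv_const (m := 0) (by simp)).continuousAt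
  have key : ∀ q, q ∈ (chartAt (EuclideanSpace ℝ (Fin d)) p).source →
      f q ∈ (chartAt H (f p)).source →
      (Function.Injective (inTangentCoordinates (𝓡 d) I id f (mfderiv (𝓡 d) I f) p q) ↔
        Function.Injective (mfderiv (𝓡 d) I f q)) := by
    intro q hq hfq
    rw [inTangentCoordinates_eq_mfderiv_comp hq hfq]
    obtain ⟨A, hA⟩ := isInvertible_mfderiv_extChartAt (I := I) (x := f p) (y := f q)
      (by simpa using hfq)
    obtain ⟨B, hB⟩ := isInvertible_mfderivWithin_extChartAt_symm (I := 𝓡 d) (x := p)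
      (y := extChartAt (𝓡 d) p q)
      ((extChartAt (𝓡 d) p).map_source (by simpa using hq))
    have hA' : Function.Injective
        (mfderiv I 𝓘(ℝ, E) (extChartAt I (f p)) (f q)) := hA ▸ A.injective
    have hB' : Function.Bijective (mfderivWithin 𝓘(ℝ, EuclideanSpace ℝ (Fin d)) (𝓡 d)
        (extChartAt (𝓡 d) p).symm (Set.range (𝓡 d)) (extChartAt (𝓡 d) p q)) := hB ▸ B.bijective
    exact (Function.Injective.of_comp_iff hA' _).trans (Function.Injective.of_comp_iff' _ hB')
  have h2 := h1.preimage_mem_nhds (ContinuousLinearMap.isOpen_injective.mem_nhds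
    ((key p (mem_chart_source _ _) (mem_chart_source _ _)).2 hp))
  filter_upwards [h2, (chartAt (EuclideanSpace ℝ (Fin d)) p).open_source.mem_nhds
      (mem_chart_source _ p), hf.continuous.continuousAt.preimage_mem_nhds
      ((chartAt H (f p)).open_source.mem_nhds (mem_chart_source _ (f p)))] with q h3 h4 h5
  exact (key q h4 h5).1 h3

end OpenSubmanifold

/-! ### Lorentz algebra -/

namespace ConformalSubmanifold

section LorentzAlgebra

variable {n : ℕ}

/-- The Lorentz inner product as a continuous bilinear map. -/
noncomputable def lorentzL (n : ℕ) : LorentzSpace n →L[ℝ] LorentzSpace n →L[ℝ] ℝ :=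
  (innerSL ℝ).bilinearComp (ContinuousLinearMap.fst ℝ _ _) (ContinuousLinearMap.fst ℝ _ _) -
    (ContinuousLinearMap.mul ℝ ℝ).bilinearComp (ContinuousLinearMap.snd ℝ _ _)
      (ContinuousLinearMap.snd ℝ _ _)

lemma lorentzL_apply (v w : LorentzSpace n) : lorentzL n v w = lorentz v w := rfl

lemma lorentz_comm (v w : LorentzSpace n) : lorentz v w = lorentz w v := by
  simp only [lorentz, real_inner_comm, mul_comm]

lemma lorentz_add_left (v v' w : LorentzSpace n) :
    lorentz (v + v') w = lorentz v w + lorentz v' w := by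
  simp [← lorentzL_apply]

lemma lorentz_sub_left (v v' w : LorentzSpace n) :
    lorentz (v - v') w = lorentz v w - lorentz v' w := by
  simp [← lorentzL_apply]

lemma lorentz_smul_left (a : ℝ) (v w : LorentzSpace n) : lorentz (a • v) w = a * lorentz v w := by
  simp [← lorentzL_apply]

lemma lorentz_add_right (v w w' : LorentzSpace n) :
    lorentz v (w + w') = lorentz v w + lorentz v w' := by
  simp [← lorentzL_apply]

lemma lorentz_sub_right (v w w' : LorentzSpace n) :
    lorentz v (w - w') = lorentz v w - lorentz v w' := by
  simp [← lorentzL_apply]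

lemma lorentz_smul_right (a : ℝ) (v w : LorentzSpace n) :
    lorentz v (a • w) = a * lorentz v w := by
  simp [← lorentzL_apply]

@[simp] lemma lorentz_zero_left (w : LorentzSpace n) : lorentz 0 w = 0 := by
  simp [← lorentzL_apply]

@[simp] lemma lorentz_zero_right (w : LorentzSpace n) : lorentz w 0 = 0 := by
  simp [← lorentzL_apply]

lemma lorentz_light_self (y : Sph n) : lorentz (light y) (light y) = 0 := by
  simp [lorentz, light]

lemma lorentz_light_neg {y y' : Sph n} (h : y ≠ y') : lorentz (light y) (light y') < 0 := by
  have h1 := lt_of_le_of_ne (real_inner_le_one_of_norm_eq_one (norm_eq_of_mem_sphere y)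
    (norm_eq_of_mem_sphere y')) fun h' => h (Subtype.ext ((inner_eq_one_iff_of_norm_eq_one
      (𝕜 := ℝ) (norm_eq_of_mem_sphere y) (norm_eq_of_mem_sphere y')).1 h'))
  simp only [lorentz, light]
  linarith

lemma lorentz_light_ne {y y' : Sph n} (h : y ≠ y') : lorentz (light y) (light y') ≠ 0 :=
  (lorentz_light_neg h).ne

lemma light_ne_zero (y : Sph n) : light y ≠ 0 := fun h => one_ne_zero (congrArg Prod.snd h)

/-- A vector that is orthogonal to a timelike vector and not spacelike vanishes. -/
lemma eq_zero_of_orthogonal_timelike {v w : LorentzSpace n} (hv : lorentz v v < 0)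
    (hvw : lorentz w v = 0) (hw : lorentz w w ≤ 0) : w = 0 := by
  obtain ⟨a, c⟩ := v
  obtain ⟨b, e⟩ := w
  simp only [lorentz, real_inner_self_eq_norm_sq] at hv hvw hw
  -- By Cauchy–Schwarz, `b·a = ec` and `‖b‖² ≤ e²` give `e²c² ≤ e²‖a‖²`. As `‖a‖² < c²`, this forces
  -- `e = 0`, and then `b = 0`.
  have h1 : |inner ℝ b a| ≤ ‖b‖ * ‖a‖ := abs_real_inner_le_norm b a
  have h2 : (e * c) ^ 2 ≤ (‖b‖ * ‖a‖) ^ 2 := by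
    have : inner ℝ b a = e * c := by linarith
    rw [← this]
    exact sq_le_sq' (by linarith [abs_le.1 h1]) (by linarith [abs_le.1 h1])
  have h3 : ‖b‖ ^ 2 * ‖a‖ ^ 2 ≤ e ^ 2 * ‖a‖ ^ 2 :=
    mul_le_mul_of_nonneg_right (by nlinarith) (by positivity)
  have h4 : e ^ 2 * (c ^ 2 - ‖a‖ ^ 2) ≤ 0 := by nlinarith
  have h5 : e = 0 := by
    by_contra h
    have : 0 < e ^ 2 * (c ^ 2 - ‖a‖ ^ 2) := by
      have : 0 < c ^ 2 - ‖a‖ ^ 2 := by nlinarith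
      positivity
    linarith
  have h6 : b = 0 := by
    rw [h5] at hw
    have : ‖b‖ ^ 2 ≤ 0 := by simpa using hw
    have : ‖b‖ = 0 := by nlinarith [norm_nonneg b]
    simpa using this
  simp [h5, h6]

lemma lorentz_light_add_light_neg {y y' : Sph n} (h : y ≠ y') :
    lorentz (light y + light y') (light y + light y') < 0 := by
  have := lorentz_light_neg h
  rw [lorentz_add_left, lorentz_add_right, lorentz_add_right, lorentz_light_self,
    lorentz_light_self, lorentz_comm (light y')]
  linarith

/-- A nonzero vector that is orthogonal to two distinct points of the light cone is spacelike. -/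
lemma lorentz_self_pos_of_orthogonal {y y' : Sph n} (h : y ≠ y') {w : LorentzSpace n}
    (hy : lorentz w (light y) = 0) (hy' : lorentz w (light y') = 0) (hw : w ≠ 0) :
    0 < lorentz w w := by
  by_contra hneg
  refine hw (eq_zero_of_orthogonal_timelike (lorentz_light_add_light_neg h) ?_ (not_lt.1 hneg))
  rw [lorentz_add_right, hy, hy', add_zero]

/-- Nondegeneracy of an `(r+1,1)`-plane: `w` would be null and orthogonal to a timelike vector. -/
lemma IsSphere.eq_zero_of_orthogonal {r : ℕ} {C : Submodule ℝ (LorentzSpace n)}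
    (hC : IsSphere r C) {w : LorentzSpace n} (hw : w ∈ C) (h : ∀ v ∈ C, lorentz w v = 0) :
    w = 0 := by
  obtain ⟨-, v, hv, hneg⟩ := hC
  exact eq_zero_of_orthogonal_timelike hneg (h v hv) (h w hw).le

/-- The point of the sphere on the line of a nonzero null vector. -/
noncomputable def pointOfNull (w : LorentzSpace n) (h : lorentz w w = 0) (h0 : w.2 ≠ 0) : Sph n :=
  ⟨w.2⁻¹ • w.1, by
    rw [mem_sphere_zero_iff_norm, norm_smul, norm_inv, Real.norm_eq_abs]
    have h1 : ‖w.1‖ ^ 2 = |w.2| ^ 2 := by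
      rw [sq_abs]
      simp only [lorentz, real_inner_self_eq_norm_sq] at h
      linarith
    have h2 : ‖w.1‖ = |w.2| := by
      rwa [sq_eq_sq₀ (norm_nonneg _) (abs_nonneg _)] at h1
    rw [h2, inv_mul_cancel₀ (abs_ne_zero.2 h0)]⟩

lemma light_pointOfNull (w : LorentzSpace n) (h : lorentz w w = 0) (h0 : w.2 ≠ 0) :
    light (pointOfNull w h h0) = w.2⁻¹ • w := by
  refine Prod.ext rfl ?_
  simp [light, h0]

lemma snd_ne_zero_of_null {w : LorentzSpace n} (h : lorentz w w = 0) (h0 : w ≠ 0) : w.2 ≠ 0 := by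
  intro h2
  refine h0 (Prod.ext ?_ h2)
  simpa [lorentz, h2] using h

/-- The orthogonal complement with respect to the Lorentz inner product. -/
noncomputable def lorentzPerp (W : Submodule ℝ (LorentzSpace n)) : Submodule ℝ (LorentzSpace n) where
  carrier := {w | ∀ v ∈ W, lorentz v w = 0}
  add_mem' ha hb v hv := by rw [lorentz_add_right, ha v hv, hb v hv, add_zero]
  zero_mem' v _ := lorentz_zero_right v
  smul_mem' a w hw v hv := by rw [lorentz_smul_right, hw v hv, mul_zero]

lemma mem_lorentzPerp {W : Submodule ℝ (LorentzSpace n)} {w : LorentzSpace n} :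
    w ∈ lorentzPerp W ↔ ∀ v ∈ W, lorentz v w = 0 := Iff.rfl

lemma finrank_add_finrank_lorentzPerp (W : Submodule ℝ (LorentzSpace n)) :
    Module.finrank ℝ W + Module.finrank ℝ (lorentzPerp W) = n + 2 := by
  let B : LinearMap.BilinForm ℝ (LorentzSpace n) :=
    LinearMap.mk₂ ℝ lorentz lorentz_add_left lorentz_smul_left lorentz_add_right lorentz_smul_right
  have hzero : ∀ v : LorentzSpace n, (∀ w, lorentz v w = 0) → v = 0 := by
    intro v hv
    -- Pairing with the time reflection of `v` gives the Euclidean square norm.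
    have h := hv (v.1, -v.2)
    simp only [lorentz, real_inner_self_eq_norm_sq] at h
    have h1 : ‖v.1‖ = 0 := pow_eq_zero_iff two_ne_zero |>.1
      (by nlinarith [sq_nonneg ‖v.1‖, sq_nonneg v.2])
    have h2 : v.2 = 0 := pow_eq_zero_iff two_ne_zero |>.1
      (by nlinarith [sq_nonneg ‖v.1‖, sq_nonneg v.2])
    exact Prod.ext (norm_eq_zero.1 h1) h2
  have hB : B.Nondegenerate :=
    ⟨fun v hv => hzero v hv, fun v hv => hzero v fun w => (lorentz_comm v w).trans (hv w)⟩
  have h1 : B.orthogonal W = lorentzPerp W := rfl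
  have h2 := LinearMap.BilinForm.finrank_orthogonal hB W
  have h3 : Module.finrank ℝ (LorentzSpace n) = n + 2 := by simp [LorentzSpace]
  have h4 := Submodule.finrank_le W
  rw [h1] at h2
  omega

end LorentzAlgebra
end ConformalSubmanifold

/-! ### Differentiation in Lorentz space and derived spaces -/

namespace ConformalSubmanifold

section Derivatives

variable {k n : ℕ} {N : Type*} [TopologicalSpace N] [ChartedSpace (EuclideanSpace ℝ (Fin k)) N]

lemma contMDiff_light : ContMDiff (𝓡 n) 𝓘(ℝ, LorentzSpace n) ∞ (light (n := n)) :=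
  contMDiff_coe_sphere.prodMk_space contMDiff_const

lemma contMDiff_lorentz {l : ℕ∞ω} {g h : N → LorentzSpace n}
    (hg : ContMDiff (𝓡 k) 𝓘(ℝ, LorentzSpace n) l g)
    (hh : ContMDiff (𝓡 k) 𝓘(ℝ, LorentzSpace n) l h) :
    ContMDiff (𝓡 k) 𝓘(ℝ, ℝ) l (fun q => lorentz (g q) (h q)) :=
  ((lorentzL n).contMDiff.comp hg).clm_apply hh

lemma hasMFDerivAt_prodMk_space {F G : Type*} [NormedAddCommGroup F] [NormedSpace ℝ F]
    [NormedAddCommGroup G] [NormedSpace ℝ G] {g : N → F} {h : N → G} {p : N}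
    {g' : EuclideanSpace ℝ (Fin k) →L[ℝ] F} {h' : EuclideanSpace ℝ (Fin k) →L[ℝ] G}
    (hg : HasMFDerivAt (𝓡 k) 𝓘(ℝ, F) g p g') (hh : HasMFDerivAt (𝓡 k) 𝓘(ℝ, G) h p h') :
    HasMFDerivAt (𝓡 k) 𝓘(ℝ, F × G) (fun q => (g q, h q)) p
      (g'.prod h' : EuclideanSpace ℝ (Fin k) →L[ℝ] F × G) :=
  ⟨hg.1.prodMk hh.1, hg.2.prodMk hh.2⟩

lemma mfderiv_lorentz {g h : N → LorentzSpace n} {p : N}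
    (hg : MDifferentiableAt (𝓡 k) 𝓘(ℝ, LorentzSpace n) g p)
    (hh : MDifferentiableAt (𝓡 k) 𝓘(ℝ, LorentzSpace n) h p) (X : TangentSpace (𝓡 k) p) :
    mfderiv (𝓡 k) 𝓘(ℝ, ℝ) (fun q => lorentz (g q) (h q)) p X =
      lorentz (vderiv g p X) (h p) + lorentz (g p) (vderiv h p X) := by
  have h1 := hasMFDerivAt_prodMk_space hg.hasMFDerivAt hh.hasMFDerivAt
  have h2 := ((lorentzL n).isBoundedBilinearMap.hasFDerivAt (g p, h p)).hasMFDerivAt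
  have h3 := (HasMFDerivAt.comp p h2 h1).mfderiv
  have h4 := DFunLike.congr_fun h3 X
  refine h4.trans ?_
  change lorentz (g p) (vderiv h p X) + lorentz (vderiv g p X) (h p) = _
  exact add_comm _ _

lemma lorentz_vderiv_add_eq_zero {g h : N → LorentzSpace n} {p : N}
    (hg : MDifferentiableAt (𝓡 k) 𝓘(ℝ, LorentzSpace n) g p)
    (hh : MDifferentiableAt (𝓡 k) 𝓘(ℝ, LorentzSpace n) h p) {a : ℝ}
    (hc : ∀ᶠ q in nhds p, lorentz (g q) (h q) = a) (X : TangentSpace (𝓡 k) p) :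
    lorentz (vderiv g p X) (h p) + lorentz (g p) (vderiv h p X) = 0 := by
  rw [← mfderiv_lorentz hg hh X]
  have h1 : (fun q => lorentz (g q) (h q)) =ᶠ[nhds p] fun _ => a := hc
  have h2 := ((hasMFDerivAt_const (I := 𝓡 k) (I' := 𝓘(ℝ, ℝ)) a p).congr_of_eventuallyEq h1).mfderiv
  exact DFunLike.congr_fun h2 X

lemma vderiv_smul {a : N → ℝ} {g : N → LorentzSpace n} {p : N}
    (ha : MDifferentiableAt (𝓡 k) 𝓘(ℝ, ℝ) a p)
    (hg : MDifferentiableAt (𝓡 k) 𝓘(ℝ, LorentzSpace n) g p) (X : TangentSpace (𝓡 k) p) {b : ℝ}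
    (hb : mfderiv (𝓡 k) 𝓘(ℝ, ℝ) a p X = b) :
    vderiv (fun q => a q • g q) p X = a p • vderiv g p X + b • g p := by
  subst hb
  have h1 := hasMFDerivAt_prodMk_space ha.hasMFDerivAt hg.hasMFDerivAt
  have h2 := ((isBoundedBilinearMap_smul (𝕜 := ℝ) (A := ℝ)
    (E := LorentzSpace n)).hasFDerivAt (a p, g p)).hasMFDerivAt
  exact DFunLike.congr_fun (HasMFDerivAt.comp p h2 h1).mfderiv X

lemma vderiv_add {g h : N → LorentzSpace n} {p : N}
    (hg : MDifferentiableAt (𝓡 k) 𝓘(ℝ, LorentzSpace n) g p)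
    (hh : MDifferentiableAt (𝓡 k) 𝓘(ℝ, LorentzSpace n) h p) (X : TangentSpace (𝓡 k) p) :
    vderiv (fun q => g q + h q) p X = vderiv g p X + vderiv h p X :=
  DFunLike.congr_fun (hg.hasMFDerivAt.add hh.hasMFDerivAt).mfderiv X

lemma vderiv_sub {g h : N → LorentzSpace n} {p : N}
    (hg : MDifferentiableAt (𝓡 k) 𝓘(ℝ, LorentzSpace n) g p)
    (hh : MDifferentiableAt (𝓡 k) 𝓘(ℝ, LorentzSpace n) h p) (X : TangentSpace (𝓡 k) p) :
    vderiv (fun q => g q - h q) p X = vderiv g p X - vderiv h p X :=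
  DFunLike.congr_fun (hg.hasMFDerivAt.sub hh.hasMFDerivAt).mfderiv X

lemma vderiv_comp {l : ℕ} {Y : Type*} [TopologicalSpace Y]
    [ChartedSpace (EuclideanSpace ℝ (Fin l)) Y] {g : N → LorentzSpace n} {h : Y → N} {p : Y}
    (hg : MDifferentiableAt (𝓡 k) 𝓘(ℝ, LorentzSpace n) g (h p))
    (hh : MDifferentiableAt (𝓡 l) (𝓡 k) h p) (X : TangentSpace (𝓡 l) p) :
    vderiv (fun q => g (h q)) p X = vderiv g (h p) (mfderiv (𝓡 l) (𝓡 k) h p X) :=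
  DFunLike.congr_fun (mfderiv_comp p hg hh) X

lemma vderiv_congr {g h : N → LorentzSpace n} {p : N} (hgh : g =ᶠ[nhds p] h)
    (X : TangentSpace (𝓡 k) p) : vderiv g p X = vderiv h p X :=
  DFunLike.congr_fun hgh.mfderiv_eq X

variable {x : N → Sph n}

lemma IsSphImmersion.contMDiff_light (hx : IsSphImmersion (k := k) x) :
    ContMDiff (𝓡 k) 𝓘(ℝ, LorentzSpace n) ∞ (fun q => light (x q)) :=
  ConformalSubmanifold.contMDiff_light.comp hx.1

lemma vderiv_light_injective (y : Sph n) : Function.Injective (vderiv (k := n) light y) := by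
  intro X Y h
  apply injective_mvfderiv_subtypeVal_sphere y
  have h1 := (contMDiff_light (n := n) y).mdifferentiableAt (by simp)
  have h2 := ((ContinuousLinearMap.fst ℝ (EuclideanSpace ℝ (Fin (n + 1))) ℝ).hasMFDerivAt
    (x := light y)).comp y h1.hasMFDerivAt
  have h3 := h2.mfderiv
  have h4 : ∀ Z, mfderiv (𝓡 n) 𝓘(ℝ, EuclideanSpace ℝ (Fin (n + 1)))
      (Subtype.val : Sph n → EuclideanSpace ℝ (Fin (n + 1))) y Z =
      (vderiv light y Z).1 := fun Z => DFunLike.congr_fun h3 Z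
  exact (h4 X).trans ((congrArg Prod.fst h).trans (h4 Y).symm)

lemma vderiv_light_comp (hx : ContMDiff (𝓡 k) (𝓡 n) ∞ x) (p : N) (X : TangentSpace (𝓡 k) p) :
    vderiv (fun q => light (x q)) p X = vderiv light (x p) (mfderiv (𝓡 k) (𝓡 n) x p X) :=
  vderiv_comp ((contMDiff_light (x p)).mdifferentiableAt (by simp))
    ((hx p).mdifferentiableAt (by simp)) X

lemma IsSphImmersion.vderiv_light_injective (hx : IsSphImmersion (k := k) x) (p : N) :
    Function.Injective (vderiv (k := k) (fun q => light (x q)) p) := by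
  intro X Y h
  rw [vderiv_light_comp hx.1, vderiv_light_comp hx.1] at h
  exact hx.2 p (ConformalSubmanifold.vderiv_light_injective _ h)

/-- The lift is normalized to time coordinate 1. The time coordinate therefore separates the line of
`x` from the image of the differential, and it reads off the coefficient of `light (x p)` in a
vector of the derived space. -/
lemma snd_vderiv_light (hx : ContMDiff (𝓡 k) (𝓡 n) ∞ x) (p : N) (X : TangentSpace (𝓡 k) p) :
    (vderiv (fun q => light (x q)) p X).2 = 0 := by
  have h1 := ((contMDiff_light.comp hx) p).mdifferentiableAt (by simp)
  have h2 := ((ContinuousLinearMap.snd ℝ (EuclideanSpace ℝ (Fin (n + 1))) ℝ).hasMFDerivAt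
    (x := light (x p))).comp p h1.hasMFDerivAt
  have h3 := DFunLike.congr_fun h2.mfderiv X
  refine h3.symm.trans ?_
  have h4 : (⇑(ContinuousLinearMap.snd ℝ (EuclideanSpace ℝ (Fin (n + 1))) ℝ) ∘ light ∘ x) =
    fun _ => (1 : ℝ) := rfl
  rw [h4, mfderiv_const]
  rfl

lemma lorentz_light_vderiv (hx : ContMDiff (𝓡 k) (𝓡 n) ∞ x) (p : N)
    (X : TangentSpace (𝓡 k) p) :
    lorentz (light (x p)) (vderiv (fun q => light (x q)) p X) = 0 := by
  have h1 := ((contMDiff_light.comp hx) p).mdifferentiableAt (by simp)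
  have h2 := lorentz_vderiv_add_eq_zero h1 h1 (a := 0)
    (Filter.Eventually.of_forall fun q => lorentz_light_self (x q)) X
  rw [lorentz_comm] at h2
  change lorentz (light (x p)) (vderiv (fun q => light (x q)) p X) +
    lorentz (light (x p)) (vderiv (fun q => light (x q)) p X) = 0 at h2
  linarith

lemma light_mem_derived (x : N → Sph n) (p : N) : light (x p) ∈ derived (k := k) x p :=
  Submodule.mem_sup_left (Submodule.mem_span_singleton_self _)

lemma vderiv_mem_derived (x : N → Sph n) (p : N) (X : TangentSpace (𝓡 k) p) :
    vderiv (fun q => light (x q)) p X ∈ derived (k := k) x p :=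
  Submodule.mem_sup_right ⟨X, rfl⟩

lemma mem_derived_iff {p : N} {w : LorentzSpace n} :
    w ∈ derived (k := k) x p ↔
      ∃ (a : ℝ) (X : TangentSpace (𝓡 k) p),
        w = a • light (x p) + vderiv (fun q => light (x q)) p X := by
  rw [derived, Submodule.mem_sup]
  constructor
  · rintro ⟨y, hy, z, ⟨X, rfl⟩, rfl⟩
    obtain ⟨a, rfl⟩ := Submodule.mem_span_singleton.1 hy
    exact ⟨a, X, rfl⟩
  · rintro ⟨a, X, rfl⟩
    exact ⟨_, Submodule.mem_span_singleton.2 ⟨a, rfl⟩, _, ⟨X, rfl⟩, rfl⟩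

lemma lorentz_light_derived (hx : ContMDiff (𝓡 k) (𝓡 n) ∞ x) {p : N} {w : LorentzSpace n}
    (hw : w ∈ derived (k := k) x p) : lorentz (light (x p)) w = 0 := by
  obtain ⟨a, X, rfl⟩ := mem_derived_iff.1 hw
  rw [lorentz_add_right, lorentz_smul_right, lorentz_light_self, lorentz_light_vderiv hx]
  simp

lemma IsSphImmersion.finrank_derived (hx : IsSphImmersion (k := k) x) (p : N) :
    Module.finrank ℝ (derived (k := k) x p) = k + 1 := by
  have h1 := Submodule.finrank_sup_add_finrank_inf_eq (Submodule.span ℝ {light (x p)})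
    (LinearMap.range (vderiv (k := k) (fun q => light (x q)) p))
  have h2 : Submodule.span ℝ {light (x p)} ⊓
      LinearMap.range (vderiv (k := k) (fun q => light (x q)) p) = ⊥ := by
    rw [Submodule.eq_bot_iff]
    rintro w ⟨hw, X, rfl⟩
    obtain ⟨a, ha⟩ := Submodule.mem_span_singleton.1 hw
    have h3 := congrArg Prod.snd ha
    rw [snd_vderiv_light hx.1] at h3
    have h4 : a = 0 := by simpa [light] using h3
    rw [← ha, h4, zero_smul]
  have h5 : Module.finrank ℝ (TangentSpace (𝓡 k) p) = k :=
    finrank_euclideanSpace_fin (𝕜 := ℝ) (n := k)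
  rw [h2, finrank_bot, finrank_span_singleton (light_ne_zero _),
    LinearMap.finrank_range_of_inj (hx.vderiv_light_injective p), h5] at h1
  rw [derived]
  omega

/-- A sphere through another point that is tangent to an immersion is spanned by that point and
the derived space of the immersion. -/
lemma IsSphere.eq_derived_sup (hx : IsSphImmersion (k := k) x) {p : N} {y : Sph n}
    (hy : x p ≠ y) {C : Submodule ℝ (LorentzSpace n)} (hC : IsSphere k C)
    (h : derived (k := k) x p ≤ C) (hyC : light y ∈ C) :
    C = derived (k := k) x p ⊔ Submodule.span ℝ {light y} := by
  symm
  apply Submodule.eq_of_le_of_finrank_eq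
  · exact sup_le h ((Submodule.span_singleton_le_iff_mem _ _).2 hyC)
  · have h1 := Submodule.finrank_sup_add_finrank_inf_eq (derived (k := k) x p)
      (Submodule.span ℝ {light y})
    have h2 : derived (k := k) x p ⊓ Submodule.span ℝ {light y} = ⊥ := by
      rw [Submodule.eq_bot_iff]
      rintro w ⟨hw, hw'⟩
      obtain ⟨a, rfl⟩ := Submodule.mem_span_singleton.1 hw'
      have h3 := lorentz_light_derived hx.1 hw
      rw [lorentz_smul_right] at h3
      rw [(mul_eq_zero.1 h3).resolve_right (lorentz_light_ne hy), zero_smul]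
    rw [h2, finrank_bot, finrank_span_singleton (light_ne_zero _), hx.finrank_derived] at h1
    rw [hC.1]
    omega

/-- Write `w` as a derived vector plus a multiple of `light y`. The first is orthogonal to `x` and
`(x, y) ≠ 0`, so the multiple vanishes. -/
lemma IsSphere.mem_derived (hx : IsSphImmersion (k := k) x) {p : N} {y : Sph n}
    (hy : x p ≠ y) {C : Submodule ℝ (LorentzSpace n)} (hC : IsSphere k C)
    (h : derived (k := k) x p ≤ C) (hyC : light y ∈ C) {w : LorentzSpace n} (hw : w ∈ C)
    (hwx : lorentz (light (x p)) w = 0) : w ∈ derived (k := k) x p := by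
  rw [hC.eq_derived_sup hx hy h hyC, Submodule.mem_sup] at hw
  obtain ⟨d, hd, e, he, rfl⟩ := hw
  obtain ⟨a, rfl⟩ := Submodule.mem_span_singleton.1 he
  rw [lorentz_add_right, lorentz_light_derived hx.1 hd, lorentz_smul_right, zero_add] at hwx
  rw [(mul_eq_zero.1 hwx).resolve_right (lorentz_light_ne hy), zero_smul, add_zero]
  exact hd

end Derivatives
end ConformalSubmanifold

/-! ### From corresponding curvature leaves to a sphere congruence -/

namespace ConformalSubmanifold

section Frames

variable {m n : ℕ} {P : Type*} [TopologicalSpace P]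
  [ChartedSpace (EuclideanSpace ℝ (Fin m)) P] [IsManifold (𝓡 m) ∞ P]

/-- The images of the differential of a smooth map have smooth local generators. -/
lemma exists_local_generators_range_vderiv {s : P → LorentzSpace n}
    (hs : ContMDiff (𝓡 m) 𝓘(ℝ, LorentzSpace n) ∞ s) (y₀ : P) :
    ∃ U : Set P, IsOpen U ∧ y₀ ∈ U ∧ ∃ e : Fin m → P → LorentzSpace n,
      (∀ i, ContMDiffOn (𝓡 m) 𝓘(ℝ, LorentzSpace n) ∞ (e i) U) ∧
      ∀ y ∈ U, LinearMap.range (vderiv (k := m) s y) =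
        Submodule.span ℝ (Set.range fun i => e i y) := by
  let c := chartAt (EuclideanSpace ℝ (Fin m)) y₀
  let h : EuclideanSpace ℝ (Fin m) → LorentzSpace n := s ∘ c.symm
  have hh : ContDiffOn ℝ ∞ h c.target :=
    (hs.comp_contMDiffOn (contMDiffOn_chart_symm (I := 𝓡 m) (n := ∞) (x := y₀))).contDiffOn
  have hh' : ContDiffOn ℝ ∞ (fderiv ℝ h) c.target :=
    hh.fderiv_of_isOpen c.open_target (by simp)
  let b := (EuclideanSpace.basisFun (Fin m) ℝ).toBasis
  refine ⟨c.source, c.open_source, mem_chart_source _ _, fun i y => fderiv ℝ h (c y) (b i),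
    fun i => ?_, fun y hy => ?_⟩
  · exact (hh'.contMDiffOn.comp (contMDiffOn_chart (I := 𝓡 m) (n := ∞) (x := y₀))
      fun y hy => c.map_source hy).clm_apply contMDiffOn_const
  · have hc := mdifferentiable_of_mem_atlas (I := 𝓡 m) (chart_mem_atlas _ y₀)
    have hd : DifferentiableAt ℝ h (c y) :=
      (hh.differentiableOn (by simp)).differentiableAt (c.open_target.mem_nhds (c.map_source hy))
    have h1 : s =ᶠ[nhds y] h ∘ c := Filter.eventually_of_mem (c.open_source.mem_nhds hy)
      fun z hz => by simp only [h, Function.comp_apply, c.left_inv hz]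
    have h2 : ∀ X, vderiv s y X = fderiv ℝ h (c y) (mfderiv (𝓡 m) (𝓡 m) c y X) := by
      intro X
      rw [vderiv_congr h1]
      exact DFunLike.congr_fun (HasMFDerivAt.comp y hd.hasFDerivAt.hasMFDerivAt
        (hc.mdifferentiableAt hy).hasMFDerivAt).mfderiv X
    have h3 : Set.range (fun i => fderiv ℝ h (c y) (b i)) = fderiv ℝ h (c y) '' Set.range b := by
      rw [← Set.range_comp]; rfl
    rw [h3]
    change _ = Submodule.span ℝ ((fderiv ℝ h (c y)).toLinearMap '' Set.range b)
    rw [← Submodule.map_span, b.span_eq]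
    ext w
    constructor
    · rintro ⟨X, rfl⟩
      exact ⟨mfderiv (𝓡 m) (𝓡 m) c y X, trivial, (h2 X).symm⟩
    · rintro ⟨Z, -, rfl⟩
      obtain ⟨X, rfl⟩ := hc.mfderiv_surjective hy Z
      exact ⟨X, h2 X⟩

end Frames

section Envelope

variable {m n : ℕ}
  {P : Type*} [TopologicalSpace P] [ChartedSpace (EuclideanSpace ℝ (Fin m)) P]
  {M : Type*} [TopologicalSpace M] [ChartedSpace (EuclideanSpace ℝ (Fin (n - 1))) M]
  {L : Type*} [TopologicalSpace L] [ChartedSpace (EuclideanSpace ℝ (Fin m)) L]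
  {s : P → LorentzSpace n} {f : M → Sph n} {π : M → P} {j : L → M}

lemma IsSpacelikeImmersion.injective (hsp : IsSpacelikeImmersion (k := m) s) (y : P) :
    Function.Injective (vderiv (k := m) s y) := by
  rw [← LinearMap.ker_eq_bot, LinearMap.ker_eq_bot']
  intro X hX
  by_contra h
  have := hsp y X h
  rw [hX, lorentz_zero_left] at this
  exact lt_irrefl _ this

lemma IsEnvelope.vderiv_comp_proj (hs : IsHypersphereFamily (k := m) s)
    (henv : IsEnvelope (m := m) s f π) (p : M) (Y : TangentSpace (𝓡 (n - 1)) p) :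
    vderiv (s ∘ π) p Y = vderiv s (π p) (mfderiv (𝓡 (n - 1)) (𝓡 m) π p Y) :=
  vderiv_comp ((hs.1 _).mdifferentiableAt (by simp))
    ((henv.smooth_proj p).mdifferentiableAt (by simp)) Y

/-- Since `π` is a submersion, `X` lifts to `M`. Differentiating `(s ∘ π, f) = 0` leaves only this
term, because `s ∘ π` is also normal to the image of `df`. -/
lemma IsEnvelope.lorentz_vderiv_light (hs : IsHypersphereFamily (k := m) s)
    (henv : IsEnvelope (m := m) s f π) (p : M) (X : TangentSpace (𝓡 m) (π p)) :
    lorentz (vderiv s (π p) X) (light (f p)) = 0 := by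
  obtain ⟨Y, rfl⟩ := henv.submersion p X
  rw [← henv.vderiv_comp_proj hs]
  have h1 := lorentz_vderiv_add_eq_zero (p := p) (a := 0)
    ((henv.touch.smooth p).mdifferentiableAt (by simp))
    ((henv.immersion.contMDiff_light p).mdifferentiableAt (by simp))
    (Filter.Eventually.of_forall fun q => henv.touch.normal q _ (light_mem_derived f q)) Y
  rwa [henv.touch.normal p _ (vderiv_mem_derived f p Y), add_zero] at h1

/-- Complementarity writes every tangent vector of `P` as the image under `dπ` of a vector tangent
to the leaf. There the shape operator equation and invariance express `ds` through the differential
of `f ∘ j`, modulo `f`. -/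
lemma IsExtendedCurvatureLeaf.range_vderiv_le_derived (hs : IsHypersphereFamily (k := m) s)
    (henv : IsEnvelope (m := m) s f π) (hj : IsExtendedCurvatureLeaf (m := m) f (s ∘ π) j)
    (hc : IsComplementaryLeaf m n π j) (u : L) :
    LinearMap.range (vderiv (k := m) s (π (j u))) ≤ derived (k := m) (fun u => f (j u)) u := by
  have hlight : ∀ Z : TangentSpace (𝓡 m) u, vderiv (fun q => light (f q)) (j u)
      (mfderiv (𝓡 m) (𝓡 (n - 1)) j u Z) = vderiv (fun u => light (f (j u))) u Z := fun Z =>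
    (vderiv_comp ((henv.immersion.contMDiff_light _).mdifferentiableAt (by simp))
      ((hj.smooth u).mdifferentiableAt (by simp)) Z).symm
  rintro _ ⟨W, rfl⟩
  obtain ⟨Y, rfl⟩ := henv.submersion (j u) W
  have hY : Y ∈ LinearMap.range (mfderiv (𝓡 m) (𝓡 (n - 1)) j u).toLinearMap ⊔
      LinearMap.ker (mfderiv (𝓡 (n - 1)) (𝓡 m) π (j u)).toLinearMap := by
    rw [(hc u).sup_eq_top]; trivial
  obtain ⟨_, ⟨X, rfl⟩, κ, hκ, rfl⟩ := Submodule.mem_sup.1 hY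
  have hκ' : mfderiv (𝓡 (n - 1)) (𝓡 m) π (j u) κ = 0 := hκ
  rw [map_add, hκ', add_zero, ← henv.vderiv_comp_proj hs]
  obtain ⟨A, hA, hinv⟩ := hj.invariant u
  obtain ⟨Z, hZ⟩ := hinv X
  have h1 := hA (mfderiv (𝓡 m) (𝓡 (n - 1)) j u X)
  rw [hZ, hlight] at h1
  have h2 := Submodule.sub_mem _ ((Submodule.mem_sup_left h1 :
    _ ∈ derived (k := m) (fun u => f (j u)) u)) (vderiv_mem_derived (fun u => f (j u)) u Z)
  rwa [add_sub_cancel_right] at h2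

lemma IsExtendedCurvatureLeaf.derived_eq (hs : IsHypersphereFamily (k := m) s)
    (hsp : IsSpacelikeImmersion (k := m) s)
    (henv : IsEnvelope (m := m) s f π) (hj : IsExtendedCurvatureLeaf (m := m) f (s ∘ π) j)
    (hc : IsComplementaryLeaf m n π j) (u : L) :
    derived (k := m) (fun u => f (j u)) u =
      Submodule.span ℝ {light (f (j u))} ⊔ LinearMap.range (vderiv (k := m) s (π (j u))) := by
  symm
  apply Submodule.eq_of_le_of_finrank_le
  · exact sup_le le_sup_left (hj.range_vderiv_le_derived hs henv hc u)
  · have h1 := Submodule.finrank_sup_add_finrank_inf_eq (Submodule.span ℝ {light (f (j u))})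
      (LinearMap.range (vderiv (k := m) s (π (j u))))
    have h2 : Submodule.span ℝ {light (f (j u))} ⊓
        LinearMap.range (vderiv (k := m) s (π (j u))) = ⊥ := by
      rw [Submodule.eq_bot_iff]
      rintro w ⟨hw, X, rfl⟩
      obtain ⟨a, ha⟩ := Submodule.mem_span_singleton.1 hw
      by_contra h
      have h3 := hsp _ X fun hX => h (by rw [hX, map_zero])
      rw [← ha, lorentz_smul_left, lorentz_smul_right, lorentz_light_self] at h3
      simp at h3
    have h5 : ∀ p : P, Module.finrank ℝ (TangentSpace (𝓡 m) p) = m :=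
      fun p => finrank_euclideanSpace_fin (𝕜 := ℝ) (n := m)
    have h6 : Module.finrank ℝ (TangentSpace (𝓡 m) u) = m :=
      finrank_euclideanSpace_fin (𝕜 := ℝ) (n := m)
    rw [h2, finrank_bot, finrank_span_singleton (light_ne_zero _),
      LinearMap.finrank_range_of_inj (hsp.injective _), h5] at h1
    refine (Submodule.finrank_add_le_finrank_add_finrank _ _).trans ?_
    have : Module.Finite ℝ (TangentSpace (𝓡 m) u) :=
      inferInstanceAs (Module.Finite ℝ (EuclideanSpace ℝ (Fin m)))
    -- An upper bound on the derived space suffices, so the rank of `f ∘ j` need not be known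
    -- beforehand.
    have h7 := LinearMap.finrank_range_le (vderiv (k := m) (fun q => light (f (j q))) u)
    change _ + Module.finrank ℝ (LinearMap.range (vderiv (k := m) (fun q => light (f (j q))) u)) ≤ _
    rw [finrank_span_singleton (light_ne_zero _)]
    omega

lemma finrank_span_pair_light {y y' : Sph n} (h : y ≠ y') :
    Module.finrank ℝ (Submodule.span ℝ {light y, light y'}) = 2 := by
  have h1 : LinearIndependent ℝ ![light y, light y'] := by
    rw [LinearIndependent.pair_iff]
    intro a b hab
    have h2 := congrArg (lorentz (light y)) hab
    have h3 := congrArg (lorentz (light y')) hab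
    rw [lorentz_add_right, lorentz_smul_right, lorentz_smul_right, lorentz_light_self] at h2 h3
    rw [lorentz_zero_right] at h2 h3
    have h4 := lorentz_light_ne h
    have h5 := lorentz_light_ne h.symm
    simp_all
  have h2 := finrank_span_eq_card h1
  rwa [Matrix.range_cons, Matrix.range_cons, Matrix.range_empty, Set.union_empty,
    Set.singleton_union, Fintype.card_fin] at h2

theorem envelopSphereCongruence_of_leaves [IsManifold (𝓡 m) ∞ P]
    (hs : IsHypersphereFamily (k := m) s)
    (hsp : IsSpacelikeImmersion (k := m) s) (henv : IsEnvelope (m := m) s f π) {j' : L → M}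
    (hj : IsExtendedCurvatureLeaf (m := m) f (s ∘ π) j)
    (hj' : IsExtendedCurvatureLeaf (m := m) f (s ∘ π) j')
    (hc : IsComplementaryLeaf m n π j) (hc' : IsComplementaryLeaf m n π j')
    (hπ : ∀ u, π (j u) = π (j' u)) (hne : ∀ u, f (j u) ≠ f (j' u)) :
    EnvelopSphereCongruence (k := m) (fun u => f (j u)) (fun u => f (j' u)) := by
  let E : L → Submodule ℝ (LorentzSpace n) := fun u =>
    LinearMap.range (vderiv (k := m) s (π (j u)))
  have hE : ∀ u, Module.finrank ℝ (E u) = m := fun u =>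
    (LinearMap.finrank_range_of_inj (hsp.injective _)).trans
      (finrank_euclideanSpace_fin (𝕜 := ℝ) (n := m))
  have hd := hj.derived_eq hs hsp henv hc
  have hd' := hj'.derived_eq hs hsp henv hc'
  have horth : ∀ u, ∀ w ∈ E u, lorentz w (light (f (j u))) = 0 := by
    rintro u _ ⟨X, rfl⟩
    exact henv.lorentz_vderiv_light hs (j u) X
  have horth' : ∀ u, ∀ w ∈ E u, lorentz w (light (f (j' u))) = 0 := by
    rintro u w hw
    simp only [E] at hw
    rw [hπ u] at hw
    obtain ⟨X, rfl⟩ := hw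
    exact henv.lorentz_vderiv_light hs (j' u) X
  refine ⟨fun u => Submodule.span ℝ {light (f (j u)), light (f (j' u))} ⊔ E u, ⟨fun u => ⟨?_, ?_⟩,
    fun u₀ => ?_⟩, fun u => ⟨?_, ?_⟩⟩
  · have h1 := Submodule.finrank_sup_add_finrank_inf_eq
      (Submodule.span ℝ {light (f (j u)), light (f (j' u))}) (E u)
    have h2 : Submodule.span ℝ {light (f (j u)), light (f (j' u))} ⊓ E u = ⊥ := by
      rw [Submodule.eq_bot_iff]
      rintro w ⟨hw, hwE⟩
      obtain ⟨a, b, hab⟩ := Submodule.mem_span_pair.1 hw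
      -- Expanding one factor in the two null points shows that `w` is null; but it is also
      -- orthogonal to both, hence spacelike unless zero.
      have h3 : lorentz w w = 0 := by
        nth_rewrite 2 [← hab]
        rw [lorentz_add_right, lorentz_smul_right, lorentz_smul_right, horth u w hwE,
          horth' u w hwE]
        simp
      by_contra h
      exact (lorentz_self_pos_of_orthogonal (hne u) (horth u w hwE) (horth' u w hwE) h).ne' h3
    rw [h2, finrank_bot, finrank_span_pair_light (hne u), hE] at h1
    change Module.finrank ℝ ↥(Submodule.span ℝ {light (f (j u)), light (f (j' u))} ⊔ E u) = _
    omega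
  · refine ⟨light (f (j u)) + light (f (j' u)), Submodule.mem_sup_left ?_,
      lorentz_light_add_light_neg (hne u)⟩
    exact Submodule.add_mem _ (Submodule.subset_span (by simp)) (Submodule.subset_span (by simp))
  · obtain ⟨U, hU, hu₀, e, he, hspan⟩ := exists_local_generators_range_vderiv hs.1 (π (j u₀))
    have hg : ContMDiff (𝓡 m) (𝓡 m) ∞ fun u => π (j u) := henv.smooth_proj.comp hj.smooth
    refine ⟨(fun u => π (j u)) ⁻¹' U, hU.preimage hg.continuous, hu₀,
      Fin.cons (fun u => light (f (j u))) (Fin.cons (fun u => light (f (j' u)))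
        fun i u => e i (π (j u))), ?_, ?_⟩
    · refine Fin.cases ?_ (Fin.cases ?_ fun i => ?_)
      · exact (henv.immersion.contMDiff_light.comp hj.smooth).contMDiffOn
      · exact (henv.immersion.contMDiff_light.comp hj'.smooth).contMDiffOn
      · exact (he i).comp hg.contMDiffOn fun u hu => hu
    · intro u hu
      have h1 : (fun i => (Fin.cons (fun u => light (f (j u))) (Fin.cons (fun u => light (f (j' u)))
          fun i u => e i (π (j u))) : Fin (m + 2) → L → LorentzSpace n) i u) =
          Fin.cons (light (f (j u))) (Fin.cons (light (f (j' u))) fun i => e i (π (j u))) := by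
        funext i
        refine Fin.cases rfl (Fin.cases rfl fun i => rfl) i
      rw [h1, Fin.range_cons, Fin.range_cons, Submodule.span_insert, Submodule.span_insert,
        ← hspan _ hu, ← sup_assoc, ← Submodule.span_insert]
  · rw [hd u]
    exact sup_le_sup_right (Submodule.span_mono (by simp)) _
  · rw [hd' u, ← hπ u]
    exact sup_le_sup_right (Submodule.span_mono (by simp)) _

end Envelope
end ConformalSubmanifold

/-! ### The normal bundle of the congruence and the null lift -/

namespace ConformalSubmanifold

open DoubleTotal

section NormalBundle

variable {m n : ℕ} {P : Type*}
  {C : P → Submodule ℝ (LorentzSpace n)} {s : P → LorentzSpace n}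

/-- The normal spaces of a congruence of spheres inside a family of hyperspheres. -/
noncomputable def normalSpace (C : P → Submodule ℝ (LorentzSpace n)) (s : P → LorentzSpace n)
    (u : P) : Submodule ℝ (LorentzSpace n) :=
  lorentzPerp (C u ⊔ Submodule.span ℝ {s u})

lemma lorentz_of_mem_normalSpace {u : P} {w v : LorentzSpace n} (hw : w ∈ normalSpace C s u)
    (hv : v ∈ C u) : lorentz v w = 0 := hw v (Submodule.mem_sup_left hv)

lemma lorentz_family_of_mem_normalSpace {u : P} {w : LorentzSpace n}
    (hw : w ∈ normalSpace C s u) : lorentz (s u) w = 0 :=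
  hw _ (Submodule.mem_sup_right (Submodule.mem_span_singleton_self _))

lemma finrank_sup_span_of_orthogonal {W : Submodule ℝ (LorentzSpace n)} {w : LorentzSpace n}
    (hw : lorentz w w = 1) (hW : ∀ v ∈ W, lorentz w v = 0) :
    Module.finrank ℝ ↥(W ⊔ Submodule.span ℝ {w}) = Module.finrank ℝ W + 1 := by
  have h1 := Submodule.finrank_sup_add_finrank_inf_eq W (Submodule.span ℝ {w})
  have h2 : W ⊓ Submodule.span ℝ {w} = ⊥ := by
    rw [Submodule.eq_bot_iff]
    rintro y ⟨hy, hy'⟩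
    obtain ⟨a, rfl⟩ := Submodule.mem_span_singleton.1 hy'
    have h3 := hW _ hy
    rw [lorentz_smul_right, hw, mul_one] at h3
    rw [h3, zero_smul]
  have h0 : w ≠ 0 := by
    rintro rfl
    simp at hw
  rw [h2, finrank_bot, finrank_span_singleton h0] at h1
  omega

/-- The additive form also yields `m + 1 ≤ n`, which makes the later truncated subtractions exact.
-/
lemma finrank_normalSpace (hC : ∀ u, IsSphere m (C u)) (hs : ∀ u, lorentz (s u) (s u) = 1)
    (hsC : ∀ u, ∀ w ∈ C u, lorentz (s u) w = 0) (u : P) :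
    m + 3 + Module.finrank ℝ (normalSpace C s u) = n + 2 := by
  have h1 := finrank_add_finrank_lorentzPerp (C u ⊔ Submodule.span ℝ {s u})
  rw [finrank_sup_span_of_orthogonal (hs u) (hsC u), (hC u).1] at h1
  exact h1

lemma isSmoothSubbundle_normalSpace [TopologicalSpace P]
    [ChartedSpace (EuclideanSpace ℝ (Fin m)) P] (hC : IsSphereCongruence (k := m) C)
    (hs : IsHypersphereFamily (k := m) s) (hsC : ∀ u, ∀ w ∈ C u, lorentz (s u) w = 0) :
    IsSmoothSubbundle m (n - 1 - m) (normalSpace C s) where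
  finrank_eq u := by
    have := finrank_normalSpace hC.1 hs.2 hsC u
    omega
  kernel u₀ := by
    obtain ⟨U, hU, hu₀, v, hv, hspan⟩ := hC.2 u₀
    -- Pairing with a frame of `C u ⊕ ⟨s u⟩` depends linearly on the frame, hence smoothly on `u`;
    -- its kernel is the normal space.
    let T : (Fin (m + 3) → LorentzSpace n) →ₗ[ℝ] LorentzSpace n →L[ℝ] (Fin (m + 3) → ℝ) :=
      { toFun := fun c => ContinuousLinearMap.pi fun i => lorentzL n (c i)
        map_add' := fun c c' => ContinuousLinearMap.ext fun w => funext fun i => by simp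
        map_smul' := fun a c => ContinuousLinearMap.ext fun w => funext fun i => by simp }
    let c : P → Fin (m + 3) → LorentzSpace n := fun u => Fin.cons (s u) fun i => v i u
    have hc : ContMDiffOn (𝓡 m) 𝓘(ℝ, Fin (m + 3) → LorentzSpace n) ∞ c U := by
      rw [contMDiffOn_pi_space]
      refine Fin.cases hs.1.contMDiffOn fun i => hv i
    have hcs : ∀ u ∈ U, C u ⊔ Submodule.span ℝ {s u} = Submodule.span ℝ (Set.range (c u)) := by
      intro u hu
      rw [hspan u hu, Fin.range_cons, Submodule.span_insert, sup_comm]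
    have hK : ∀ u ∈ U, ∀ w, w ∈ normalSpace C s u ↔ T (c u) w = 0 := by
      intro u hu w
      rw [normalSpace, hcs u hu, mem_lorentzPerp, funext_iff]
      constructor
      · intro h i
        exact h _ (Submodule.subset_span ⟨i, rfl⟩)
      · intro h y hy
        induction hy using Submodule.span_induction with
        | mem y hy =>
          obtain ⟨i, rfl⟩ := hy
          exact h i
        | zero => exact lorentz_zero_left w
        | add y y' _ _ h h' => rw [lorentz_add_left, h, h', add_zero]
        | smul a y _ h => rw [lorentz_smul_left, h, mul_zero]
    refine ⟨U, hU, hu₀, m + 3, fun u => T (c u),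
      (LinearMap.toContinuousLinearMap T).contMDiff.comp_contMDiffOn hc, hK, ?_⟩
    have h1 : LinearMap.ker (T (c u₀)).toLinearMap = normalSpace C s u₀ := by
      ext w
      exact (hK u₀ hu₀ w).symm
    have h2 := LinearMap.finrank_range_add_finrank_ker (T (c u₀)).toLinearMap
    have h3 := finrank_normalSpace hC.1 hs.2 hsC u₀
    have h4 : Module.finrank ℝ (LorentzSpace n) = n + 2 := by simp [LorentzSpace]
    rw [h1, h4] at h2
    have h5 : LinearMap.range (T (c u₀)).toLinearMap = ⊤ := by
      apply Submodule.eq_top_of_finrank_eq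
      rw [Module.finrank_fin_fun]
      omega
    exact LinearMap.range_eq_top.1 h5

end NormalBundle

/-- A pair of pointwise distinct immersions that envelop the sphere congruence `C`, and a family
`s` of hyperspheres that contain the spheres of `C` and have derivatives tangent to both
immersions. -/
structure IsEnvelopedPair {m n : ℕ} {P : Type*} [TopologicalSpace P]
    [ChartedSpace (EuclideanSpace ℝ (Fin m)) P]
    (X : Bool → P → Sph n) (C : P → Submodule ℝ (LorentzSpace n)) (s : P → LorentzSpace n) :
    Prop where
  immersion : ∀ b, IsSphImmersion (k := m) (X b)
  ne : ∀ b u, X b u ≠ X (!b) u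
  congruence : IsSphereCongruence (k := m) C
  derived_le : ∀ b u, derived (k := m) (X b) u ≤ C u
  family : IsHypersphereFamily (k := m) s
  orthogonal : ∀ u, ∀ w ∈ C u, lorentz (s u) w = 0
  vderiv_mem : ∀ b u (Z : TangentSpace (𝓡 m) u), vderiv s u Z ∈ derived (k := m) (X b) u

section NullLift

variable {m n d : ℕ} {P : Type*} [TopologicalSpace P]
  [ChartedSpace (EuclideanSpace ℝ (Fin m)) P]
  {X : Bool → P → Sph n} {C : P → Submodule ℝ (LorentzSpace n)} {s : P → LorentzSpace n}

/-- The coefficient of the quadratic term of the null lift. -/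
noncomputable def nullCoeff (X : Bool → P → Sph n) (b : Bool) (u : P) : LorentzSpace n :=
  (-(2 * lorentz (light (X b u)) (light (X (!b) u)))⁻¹) • light (X (!b) u)

/-- The null vector that represents a normal vector of the sphere congruence at one of the
enveloping immersions. -/
noncomputable def nullLift (X : Bool → P → Sph n) {N : P → Submodule ℝ (LorentzSpace n)}
    (q : DoubleTotal N) : LorentzSpace n :=
  light (X (label q) (base q)) + vec q + lorentz (vec q) (vec q) • nullCoeff X (label q) (base q)

namespace IsEnvelopedPair

variable (h : IsEnvelopedPair (m := m) X C s)
include h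

lemma light_mem (b : Bool) (u : P) : light (X b u) ∈ C u :=
  h.derived_le b u (light_mem_derived _ _)

lemma light_mem' (b : Bool) (u : P) : light (X (!b) u) ∈ C u := h.light_mem (!b) u

lemma lorentz_vderiv_family (b : Bool) (u : P) (Z : TangentSpace (𝓡 m) u) :
    lorentz (light (X b u)) (vderiv s u Z) = 0 :=
  lorentz_light_derived (h.immersion b).1 (h.vderiv_mem b u Z)

lemma lorentz_nullLift_self (q : DoubleTotal (normalSpace C s)) :
    lorentz (nullLift X q) (nullLift X q) = 0 := by
  have h1 := lorentz_of_mem_normalSpace q.2 (h.light_mem (label q) (base q))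
  have h2 := lorentz_of_mem_normalSpace q.2 (h.light_mem' (label q) (base q))
  have h3 := lorentz_light_ne (h.ne (label q) (base q))
  change lorentz _ (vec q) = 0 at h1
  change lorentz _ (vec q) = 0 at h2
  have h4 := (lorentz_comm (vec q) _).trans h1
  have h5 := (lorentz_comm (vec q) _).trans h2
  simp only [nullLift, nullCoeff, lorentz_add_left, lorentz_add_right, lorentz_smul_left,
    lorentz_smul_right, lorentz_light_self, h1, h2, h4, h5]
  rw [lorentz_comm (light (X (!label q) (base q)))]
  field_simp
  ring

lemma lorentz_light_nullLift (q : DoubleTotal (normalSpace C s)) :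
    lorentz (light (X (!label q) (base q))) (nullLift X q) =
      lorentz (light (X (label q) (base q))) (light (X (!label q) (base q))) := by
  have h2 := lorentz_of_mem_normalSpace q.2 (h.light_mem' (label q) (base q))
  change lorentz _ (vec q) = 0 at h2
  simp only [nullLift, nullCoeff, lorentz_add_right, lorentz_smul_right, lorentz_light_self, h2]
  rw [lorentz_comm]
  ring

lemma nullLift_snd_ne_zero (q : DoubleTotal (normalSpace C s)) : (nullLift X q).2 ≠ 0 := by
  refine snd_ne_zero_of_null (h.lorentz_nullLift_self q) fun h0 => ?_
  have h1 := h.lorentz_light_nullLift q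
  rw [h0, lorentz_zero_right] at h1
  exact lorentz_light_ne (h.ne _ _) h1.symm

lemma lorentz_family_nullLift (q : DoubleTotal (normalSpace C s)) :
    lorentz (s (base q)) (nullLift X q) = 0 := by
  have h1 := lorentz_family_of_mem_normalSpace q.2
  change lorentz (s (base q)) (vec q) = 0 at h1
  simp only [nullLift, nullCoeff, lorentz_add_right, lorentz_smul_right, h1,
    h.orthogonal _ _ (h.light_mem (label q) (base q)),
    h.orthogonal _ _ (h.light_mem' (label q) (base q))]
  simp

lemma lorentz_vderiv_nullLift (q : DoubleTotal (normalSpace C s))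
    (Z : TangentSpace (𝓡 m) (base q)) :
    lorentz (vderiv s (base q) Z) (nullLift X q) = 0 := by
  have h1 := lorentz_of_mem_normalSpace q.2 (h.derived_le true _ (h.vderiv_mem true (base q) Z))
  change lorentz _ (vec q) = 0 at h1
  have h2 : ∀ b, lorentz (vderiv s (base q) Z) (light (X b (base q))) = 0 := fun b =>
    (lorentz_comm _ _).trans (h.lorentz_vderiv_family b (base q) Z)
  simp only [nullLift, nullCoeff, lorentz_add_right, lorentz_smul_right, h1, h2]
  simp

/-- The envelope. -/
noncomputable def envelope (q : DoubleTotal (normalSpace C s)) : Sph n :=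
  pointOfNull (nullLift X q) (h.lorentz_nullLift_self q) (h.nullLift_snd_ne_zero q)

lemma light_envelope (q : DoubleTotal (normalSpace C s)) :
    light (h.envelope q) = (nullLift X q).2⁻¹ • nullLift X q :=
  light_pointOfNull _ _ _

/-- The copies of the zero section. -/
def zeroSection (_ : IsEnvelopedPair (m := m) X C s) (b : Bool) (u : P) :
    DoubleTotal (normalSpace C s) :=
  ⟨(u, b, 0), Submodule.zero_mem _⟩

lemma envelope_zeroSection (b : Bool) (u : P) : h.envelope (h.zeroSection b u) = X b u := by
  have h1 : nullLift X (h.zeroSection b u) = light (X b u) := by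
    simp [nullLift, zeroSection, vec, label, base]
  apply Subtype.ext
  change (nullLift X (h.zeroSection b u)).2⁻¹ • (nullLift X (h.zeroSection b u)).1 = _
  rw [h1]
  simp [light]

lemma exists_sphere (u : P) : ∃ W : Submodule ℝ (LorentzSpace n), IsSphere (n - m - 1) W ∧
    ∀ q : DoubleTotal (normalSpace C s), base q = u → light (h.envelope q) ∈ W := by
  have hne : X true u ≠ X false u := h.ne true u
  refine ⟨Submodule.span ℝ {light (X true u), light (X false u)} ⊔ normalSpace C s u,
    ⟨?_, light (X true u) + light (X false u), Submodule.mem_sup_left ?_,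
      lorentz_light_add_light_neg hne⟩, ?_⟩
  · have h1 := Submodule.finrank_sup_add_finrank_inf_eq
      (Submodule.span ℝ {light (X true u), light (X false u)}) (normalSpace C s u)
    have h2 : Submodule.span ℝ {light (X true u), light (X false u)} ⊓ normalSpace C s u = ⊥ := by
      rw [Submodule.eq_bot_iff]
      rintro w ⟨hw, hwN⟩
      have hwC : w ∈ C u := by
        refine Submodule.span_le.2 ?_ hw
        rintro y (rfl | rfl)
        · exact h.light_mem true u
        · exact h.light_mem false u
      exact (h.congruence.1 u).eq_zero_of_orthogonal hwC fun v hv =>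
        (lorentz_comm _ _).trans (lorentz_of_mem_normalSpace hwN hv)
    have h3 := finrank_normalSpace h.congruence.1 h.family.2 h.orthogonal u
    rw [h2, finrank_bot, finrank_span_pair_light hne] at h1
    omega
  · exact Submodule.add_mem _ (Submodule.subset_span (by simp)) (Submodule.subset_span (by simp))
  · rintro q rfl
    have h1 : ∀ b, light (X b (base q)) ∈
        Submodule.span ℝ {light (X true (base q)), light (X false (base q))} := by
      rintro (_ | _)
      · exact Submodule.subset_span (by simp)
      · exact Submodule.subset_span (by simp)
    rw [light_envelope]
    refine Submodule.smul_mem _ _ (Submodule.add_mem _ (Submodule.add_mem _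
      (Submodule.mem_sup_left (h1 _)) (Submodule.mem_sup_right q.2)) ?_)
    exact Submodule.smul_mem _ _ (Submodule.smul_mem _ _ (Submodule.mem_sup_left (h1 _)))

end IsEnvelopedPair

end NullLift
end ConformalSubmanifold

namespace ConformalSubmanifold

open DoubleTotal

section EnvelopeManifold

variable {m n d : ℕ} {P : Type*} [TopologicalSpace P]
  [ChartedSpace (EuclideanSpace ℝ (Fin m)) P]
  {X : Bool → P → Sph n} {C : P → Submodule ℝ (LorentzSpace n)} {s : P → LorentzSpace n}

lemma eventually_label_eq {P : Type*} [TopologicalSpace P] {N : P → Submodule ℝ (LorentzSpace n)}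
    (p : DoubleTotal N) : ∀ᶠ q in nhds p, label q = label p := by
  have h : Continuous (label : DoubleTotal N → Bool) :=
    continuous_fst.comp (continuous_snd.comp continuous_subtype_val)
  exact (isOpen_discrete {label p}).mem_nhds rfl |> h.continuousAt.preimage_mem_nhds

lemma contMDiff_nullCoeff (hX : ∀ b, IsSphImmersion (k := m) (X b))
    (hne : ∀ b u, X b u ≠ X (!b) u) (b : Bool) :
    ContMDiff (𝓡 m) 𝓘(ℝ, LorentzSpace n) ∞ (nullCoeff X b) := by
  have h1 : ContMDiff (𝓡 m) 𝓘(ℝ, ℝ) ∞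
      fun u => 2 * lorentz (light (X b u)) (light (X (!b) u)) :=
    contMDiff_const.mul (contMDiff_lorentz (hX b).contMDiff_light (hX (!b)).contMDiff_light)
  have h2 := h1.inv₀ fun u => mul_ne_zero two_ne_zero (lorentz_light_ne (hne b u))
  exact h2.neg.smul (hX (!b)).contMDiff_light

variable [IsManifold (𝓡 m) ∞ P]

section Smoothness

variable {N : P → Submodule ℝ (LorentzSpace n)}
  [ChartedSpace (EuclideanSpace ℝ (Fin d)) (DoubleTotal N)]
  (hat : ∀ c ∈ atlas (EuclideanSpace ℝ (Fin d)) (DoubleTotal N), IsBundleChart m d c)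
include hat

lemma contMDiff_comp_base {g : Bool → P → LorentzSpace n}
    (hg : ∀ b, ContMDiff (𝓡 m) 𝓘(ℝ, LorentzSpace n) ∞ (g b)) :
    ContMDiff (𝓡 d) 𝓘(ℝ, LorentzSpace n) ∞ fun q : DoubleTotal N => g (label q) (base q) := by
  intro p
  refine (((hg (label p)).comp (contMDiff_base hat)) p).congr_of_eventuallyEq ?_
  filter_upwards [eventually_label_eq p] with q hq
  rw [hq]; rfl

lemma vderiv_comp_base {g : Bool → P → LorentzSpace n}
    (hg : ∀ b, ContMDiff (𝓡 m) 𝓘(ℝ, LorentzSpace n) ∞ (g b)) (p : DoubleTotal N)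
    (Y : TangentSpace (𝓡 d) p) :
    vderiv (fun q : DoubleTotal N => g (label q) (base q)) p Y =
      vderiv (g (label p)) (base p) (mfderiv (𝓡 d) (𝓡 m) base p Y) := by
  rw [← vderiv_comp ((hg (label p) _).mdifferentiableAt (by simp))
    ((contMDiff_base hat p).mdifferentiableAt (by simp))]
  refine vderiv_congr ?_ Y
  filter_upwards [eventually_label_eq p] with q hq
  rw [hq]

lemma contMDiff_nullLift (hX : ∀ b, IsSphImmersion (k := m) (X b))
    (hne : ∀ b u, X b u ≠ X (!b) u) :
    ContMDiff (𝓡 d) 𝓘(ℝ, LorentzSpace n) ∞ fun q : DoubleTotal N => nullLift X q :=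
  ((contMDiff_comp_base hat fun b => (hX b).contMDiff_light).add (contMDiff_vec hat)).add
    ((contMDiff_lorentz (contMDiff_vec hat) (contMDiff_vec hat)).smul
      (contMDiff_comp_base hat fun b => contMDiff_nullCoeff hX hne b))

/-- The derivative of the null lift at the zero section. -/
lemma vderiv_nullLift (hX : ∀ b, IsSphImmersion (k := m) (X b))
    (hne : ∀ b u, X b u ≠ X (!b) u) {p : DoubleTotal N} (hp : vec p = 0)
    (Y : TangentSpace (𝓡 d) p) :
    vderiv (fun q : DoubleTotal N => nullLift X q) p Y =
      vderiv (fun u => light (X (label p) u)) (base p) (mfderiv (𝓡 d) (𝓡 m) base p Y) +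
        vderiv (fun q : DoubleTotal N => vec q) p Y := by
  have h1 := contMDiff_comp_base hat fun b => (hX b).contMDiff_light
  have h2 := contMDiff_vec hat
  have h3 := contMDiff_lorentz h2 h2
  have h4 := contMDiff_comp_base hat fun b => contMDiff_nullCoeff hX hne b
  have e1 := vderiv_add (((h1.add h2) p).mdifferentiableAt (by simp))
    (((h3.smul h4) p).mdifferentiableAt (by simp)) Y
  have e2 := vderiv_add ((h1 p).mdifferentiableAt (by simp))
    ((h2 p).mdifferentiableAt (by simp)) Y
  have e3 : mfderiv (𝓡 d) 𝓘(ℝ, ℝ) (fun q : DoubleTotal N => lorentz (vec q) (vec q)) p Y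
      = (0 : ℝ) := by
    refine (mfderiv_lorentz ((h2 p).mdifferentiableAt (by simp))
      ((h2 p).mdifferentiableAt (by simp)) Y).trans ?_
    change lorentz (vderiv vec p Y) (vec p) + lorentz (vec p) (vderiv vec p Y) = 0
    rw [hp, lorentz_zero_left, lorentz_zero_right, add_zero]
  have e4 := vderiv_smul ((h3 p).mdifferentiableAt (by simp))
    ((h4 p).mdifferentiableAt (by simp)) Y e3
  have e5 := vderiv_comp_base hat (fun b => (hX b).contMDiff_light) p Y
  refine e1.trans ?_
  rw [hp, lorentz_zero_left, zero_smul, zero_smul, add_zero] at e4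
  refine (congrArg₂ (· + ·) e2 e4).trans ?_
  rw [add_zero]
  exact congrArg (· + _) e5

end Smoothness

namespace IsEnvelopedPair

variable (h : IsEnvelopedPair (m := m) X C s)
  [ChartedSpace (EuclideanSpace ℝ (Fin d)) (DoubleTotal (normalSpace C s))]
  (hat : ∀ c ∈ atlas (EuclideanSpace ℝ (Fin d)) (DoubleTotal (normalSpace C s)),
    IsBundleChart m d c)
include h hat

lemma contMDiff_envelope : ContMDiff (𝓡 d) (𝓡 n) ∞ h.envelope := by
  have := isManifold hat
  have h1 := contMDiff_nullLift (n := n) hat h.immersion h.ne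
  have h2 : ContMDiff (𝓡 d) 𝓘(ℝ, ℝ) ∞
      fun q : DoubleTotal (normalSpace C s) => (nullLift X q).2 :=
    (contDiff_snd.contMDiff).comp h1
  have h3 : ContMDiff (𝓡 d) 𝓘(ℝ, EuclideanSpace ℝ (Fin (n + 1))) ∞
      fun q : DoubleTotal (normalSpace C s) => (nullLift X q).1 :=
    (contDiff_fst.contMDiff).comp h1
  exact ((h2.inv₀ h.nullLift_snd_ne_zero).smul h3).codRestrict_sphere _

lemma contMDiff_zeroSection (b : Bool) : ContMDiff (𝓡 m) (𝓡 d) ∞ (h.zeroSection b) :=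
  contMDiff_of hat contMDiff_id continuous_const contMDiff_const

lemma lorentz_vderiv_vec {p : DoubleTotal (normalSpace C s)} (hp : vec p = 0)
    (Y : TangentSpace (𝓡 d) p) {w : LorentzSpace n} (hw : w ∈ C (base p)) :
    lorentz (vderiv (fun q : DoubleTotal (normalSpace C s) => vec q) p Y) w = 0 := by
  obtain ⟨U, hU, hpU, v, hv, hspan⟩ := h.congruence.2 (base p)
  rw [hspan _ hpU] at hw
  have hbase := contMDiff_base hat
  induction hw using Submodule.span_induction with
  | mem y hy =>
    obtain ⟨i, rfl⟩ := hy
    have h1 := ((hv i).contMDiffAt (hU.mem_nhds hpU)).comp p (hbase p)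
    have h2 := lorentz_vderiv_add_eq_zero (a := 0)
      ((contMDiff_vec hat p).mdifferentiableAt (by simp)) (h1.mdifferentiableAt (by simp)) (by
        filter_upwards [(hU.preimage hbase.continuous).mem_nhds hpU] with q hq
        refine (lorentz_comm _ _).trans (lorentz_of_mem_normalSpace q.2 ?_)
        change v i (base q) ∈ C (base q)
        rw [hspan _ hq]
        exact Submodule.subset_span ⟨i, rfl⟩) Y
    rw [hp, lorentz_zero_left, add_zero] at h2
    exact h2
  | zero => exact lorentz_zero_right _
  | add y y' _ _ h h' => rw [lorentz_add_right, h, h', add_zero]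
  | smul a y _ h => rw [lorentz_smul_right, h, mul_zero]

lemma mfderiv_envelope_injective (b : Bool) (u : P) :
    Function.Injective (mfderiv (𝓡 d) (𝓡 n) h.envelope (h.zeroSection b u)) := by
  let p := h.zeroSection b u
  have hp : vec p = 0 := rfl
  rw [injective_iff_map_eq_zero]
  intro Y hY
  have h1 := contMDiff_nullLift (n := n) hat h.immersion h.ne
  have h2 : ContMDiff (𝓡 d) 𝓘(ℝ, ℝ) ∞
      fun q : DoubleTotal (normalSpace C s) => (nullLift X q).2 :=
    (contDiff_snd.contMDiff).comp h1
  have h3 := contMDiff_light.comp (h.contMDiff_envelope hat)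
  have h4 : (fun q : DoubleTotal (normalSpace C s) => nullLift X q) =
      fun q => (nullLift X q).2 • light (h.envelope q) := by
    funext q
    rw [h.light_envelope, smul_smul, mul_inv_cancel₀ (h.nullLift_snd_ne_zero q), one_smul]
  have h5 : vderiv (fun q => light (h.envelope q)) p Y = 0 := by
    rw [vderiv_light_comp (h.contMDiff_envelope hat), hY, map_zero]
  obtain ⟨a, ha⟩ : ∃ a : ℝ, mfderiv (𝓡 d) 𝓘(ℝ, ℝ)
      (fun q : DoubleTotal (normalSpace C s) => (nullLift X q).2) p Y = a := ⟨_, rfl⟩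
  have h6 := vderiv_smul ((h2 p).mdifferentiableAt (by simp))
    ((h3 p).mdifferentiableAt (by simp)) Y ha
  have h7 : vderiv (fun q : DoubleTotal (normalSpace C s) => nullLift X q) p Y =
      a • light (X b u) := by
    rw [h4]
    refine h6.trans ?_
    refine (congrArg₂ (· + ·) ((congrArg _ h5).trans (smul_zero _))
      (congrArg (a • light ·) (h.envelope_zeroSection b u))).trans (zero_add _)
  rw [vderiv_nullLift hat h.immersion h.ne hp] at h7
  let Z : TangentSpace (𝓡 m) u := mfderiv (𝓡 d) (𝓡 m) base p Y
  let dv : LorentzSpace n := vderiv (fun q : DoubleTotal (normalSpace C s) => vec q) p Y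
  have h8 : vderiv (fun u => light (X b u)) u Z + dv = a • light (X b u) := h7
  have hdv : dv = a • light (X b u) - vderiv (fun u => light (X b u)) u Z := by
    rw [← h8, add_sub_cancel_left]
  have hdvC : dv ∈ C u := by
    rw [hdv]
    exact Submodule.sub_mem _ (Submodule.smul_mem _ _ (h.light_mem b u))
      (h.derived_le b u (vderiv_mem_derived _ _ _))
  have hdv0 : dv = 0 := (h.congruence.1 u).eq_zero_of_orthogonal hdvC
    fun v hv => h.lorentz_vderiv_vec hat hp Y hv
  rw [hdv0, add_zero] at h8
  have h9 := congrArg Prod.snd h8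
  rw [snd_vderiv_light (h.immersion b).1] at h9
  have ha0 : a = 0 := by simpa [light] using h9.symm
  rw [ha0, zero_smul] at h8
  have hZ : Z = 0 := (h.immersion b).vderiv_light_injective u (h8.trans (map_zero _).symm)
  exact eq_zero_of_mfderiv_eq_zero hat p Y hZ hdv0

end IsEnvelopedPair

end EnvelopeManifold

section TangentOperator

variable {m n : ℕ} {P : Type*} [TopologicalSpace P] [ChartedSpace (EuclideanSpace ℝ (Fin m)) P]
  {x : P → Sph n} {s : P → LorentzSpace n}

/-- If the derivative of `s` takes values in the derived spaces of an immersion, then it is given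
by a tangent endomorphism modulo the immersion. -/
lemma exists_tangent_operator (hx : IsSphImmersion (k := m) x) (u : P)
    (hs : ∀ Z : TangentSpace (𝓡 m) u, vderiv s u Z ∈ derived (k := m) x u) :
    ∃ B : TangentSpace (𝓡 m) u →ₗ[ℝ] TangentSpace (𝓡 m) u, ∀ Z,
      vderiv s u Z + vderiv (fun q => light (x q)) u (B Z) ∈ Submodule.span ℝ {light (x u)} := by
  obtain ⟨g, hg⟩ := LinearMap.exists_leftInverse_of_injective
    (vderiv (k := m) (fun q => light (x q)) u)
    (LinearMap.ker_eq_bot.2 (hx.vderiv_light_injective u))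
  have hg' : ∀ Z, g (vderiv (fun q => light (x q)) u Z) = Z := fun Z => LinearMap.congr_fun hg Z
  refine ⟨-(g ∘ₗ (vderiv s u - ((LinearMap.snd ℝ _ ℝ) ∘ₗ vderiv s u).smulRight (light (x u)))),
    fun Z => ?_⟩
  obtain ⟨a, W, haW⟩ := mem_derived_iff.1 (hs Z)
  have h1 : (vderiv s u Z).2 = a := by
    rw [haW, Prod.snd_add, snd_vderiv_light hx.1]
    simp [light]
  have h2 : (-(g ∘ₗ (vderiv s u - ((LinearMap.snd ℝ _ ℝ) ∘ₗ vderiv s u).smulRight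
      (light (x u))))) Z = -W := by
    change -(g (vderiv s u Z - (vderiv s u Z).2 • light (x u))) = -W
    rw [h1, haW, add_sub_cancel_left, hg']
  rw [h2, map_neg, haW, add_neg_cancel_right]
  exact Submodule.mem_span_singleton.2 ⟨a, rfl⟩

end TangentOperator
end ConformalSubmanifold

namespace ConformalSubmanifold

open DoubleTotal

/-- An enveloped pair consists of two extended curvature leaves of an envelope of the family. -/
theorem IsEnvelopedPair.exists_envelope {m n : ℕ} {P : Type u} [TopologicalSpace P] [T2Space P]
    [SecondCountableTopology P] [ChartedSpace (EuclideanSpace ℝ (Fin m)) P]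
    [IsManifold (𝓡 m) ∞ P] {X : Bool → P → Sph n} {C : P → Submodule ℝ (LorentzSpace n)}
    {s : P → LorentzSpace n} (h : IsEnvelopedPair (m := m) X C s) :
    ∃ (M : Type u) (_ : TopologicalSpace M) (_ : T2Space M) (_ : SecondCountableTopology M)
      (_ : ChartedSpace (EuclideanSpace ℝ (Fin (n - 1))) M) (_ : IsManifold (𝓡 (n - 1)) ∞ M)
      (f : M → Sph n) (π : M → P) (J : Bool → P → M),
      IsEnvelope (m := m) s f π ∧
      (∀ u, ∃ C : Submodule ℝ (LorentzSpace n), IsSphere (n - m - 1) C ∧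
        ∀ p, π p = u → light (f p) ∈ C) ∧
      ∀ b, (∀ u, π (J b u) = u) ∧ (∀ u, f (J b u) = X b u) ∧
        IsExtendedCurvatureLeaf (m := m) f (s ∘ π) (J b) := by
  have : SecondCountableTopology (DoubleTotal (normalSpace C s)) :=
    TopologicalSpace.Subtype.secondCountableTopology {q : P × Bool × LorentzSpace n |
      q.2.2 ∈ normalSpace C s q.1}
  have hN := isSmoothSubbundle_normalSpace h.congruence h.family h.orthogonal
  have hd : ∀ _ : P, m + (n - 1 - m) = n - 1 := fun u => by
    have := finrank_normalSpace h.congruence.1 h.family.2 h.orthogonal u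
    omega
  let _ := DoubleTotal.chartedSpace hN hd
  have hat : ∀ c ∈ atlas (EuclideanSpace ℝ (Fin (n - 1))) (DoubleTotal (normalSpace C s)),
      IsBundleChart m (n - 1) c := fun c hc => hc
  have := isManifold hat
  have hf := h.contMDiff_envelope hat
  let O : TopologicalSpace.Opens (DoubleTotal (normalSpace C s)) :=
    ⟨{q | Function.Injective (mfderiv (𝓡 (n - 1)) (𝓡 n) h.envelope q)},
      isOpen_injective_mfderiv hf⟩
  have hval : ContMDiff (𝓡 (n - 1)) (𝓡 (n - 1)) ∞ (Subtype.val : O → _) := contMDiff_subtype_val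
  let f : O → Sph n := fun q => h.envelope q.1
  let π : O → P := fun q => base q.1
  let J : Bool → P → O := fun b u => ⟨h.zeroSection b u, h.mfderiv_envelope_injective hat b u⟩
  have hfs : ContMDiff (𝓡 (n - 1)) (𝓡 n) ∞ f := hf.comp hval
  have hπs : ContMDiff (𝓡 (n - 1)) (𝓡 m) ∞ π := (contMDiff_base hat).comp hval
  have hJs : ∀ b, ContMDiff (𝓡 m) (𝓡 (n - 1)) ∞ (J b) := fun b =>
    (ContMDiff.subtypeVal_comp_iff O (J b)).1 (h.contMDiff_zeroSection hat b)
  have hπd : ∀ p, mfderiv (𝓡 (n - 1)) (𝓡 m) π p = (mfderiv (𝓡 (n - 1)) (𝓡 m) base p.1).comp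
      (mfderiv (𝓡 (n - 1)) (𝓡 (n - 1)) Subtype.val p) := fun p =>
    mfderiv_comp p ((contMDiff_base hat p.1).mdifferentiableAt (by simp))
      ((hval p).mdifferentiableAt (by simp))
  have hfd : ∀ p, mfderiv (𝓡 (n - 1)) (𝓡 n) f p =
      (mfderiv (𝓡 (n - 1)) (𝓡 n) h.envelope p.1).comp
      (mfderiv (𝓡 (n - 1)) (𝓡 (n - 1)) Subtype.val p) := fun p =>
    mfderiv_comp p ((hf p.1).mdifferentiableAt (by simp)) ((hval p).mdifferentiableAt (by simp))
  have hfX : ∀ b u, f (J b u) = X b u := h.envelope_zeroSection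
  have hνd : ∀ p (Y : TangentSpace (𝓡 (n - 1)) p), vderiv (s ∘ π) p Y =
      vderiv s (π p) (mfderiv (𝓡 (n - 1)) (𝓡 m) π p Y) := fun p Y =>
    vderiv_comp ((h.family.1 _).mdifferentiableAt (by simp))
      ((hπs p).mdifferentiableAt (by simp)) Y
  have hsl : ∀ p, lorentz ((s ∘ π) p) (light (f p)) = 0 := by
    intro p
    change lorentz (s (base p.1)) (light (h.envelope p.1)) = 0
    rw [h.light_envelope, lorentz_smul_right, h.lorentz_family_nullLift, mul_zero]
  have hνs : ContMDiff (𝓡 (n - 1)) 𝓘(ℝ, LorentzSpace n) ∞ (s ∘ π) := h.family.1.comp hπs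
  have hls := contMDiff_light.comp hfs
  have hJd : ∀ b u Z, mfderiv (𝓡 (n - 1)) (𝓡 m) π (J b u) (mfderiv (𝓡 m) (𝓡 (n - 1)) (J b) u Z)
      = Z := by
    intro b u Z
    have e1 := mfderiv_comp u ((hπs (J b u)).mdifferentiableAt (by simp))
      ((hJs b u).mdifferentiableAt (by simp))
    have e2 : π ∘ J b = id := rfl
    rw [e2, mfderiv_id] at e1
    exact (DFunLike.congr_fun e1 Z).symm
  refine ⟨O, inferInstance, inferInstance,
    TopologicalSpace.Subtype.secondCountableTopology _, inferInstance, inferInstance, f, π, J,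
    ⟨⟨hfs, fun p => ?_⟩, hπs, fun p => ?_, ⟨hνs, fun p => h.family.2 _, fun p w hw => ?_⟩⟩,
    fun u => ?_, fun b => ⟨fun u => rfl, hfX b, hJs b, fun u => ?_, fun u => ?_⟩⟩
  · rw [hfd p]
    exact p.2.comp (mfderiv_opens_val_bijective O p).1
  · rw [hπd p]
    exact (mfderiv_base_surjective hat p.1).comp (mfderiv_opens_val_bijective O p).2
  · obtain ⟨a, Y, rfl⟩ := mem_derived_iff.1 hw
    have e1 := lorentz_vderiv_add_eq_zero ((hνs p).mdifferentiableAt (by simp))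
      ((hls p).mdifferentiableAt (by simp)) (Filter.Eventually.of_forall hsl) Y
    have e2 : lorentz (vderiv (s ∘ π) p Y) (light (f p)) = 0 := by
      rw [hνd]
      change lorentz (vderiv s (base p.1) _) (light (h.envelope p.1)) = 0
      rw [h.light_envelope, lorentz_smul_right, h.lorentz_vderiv_nullLift, mul_zero]
    have e3 : lorentz ((s ∘ π) p) (vderiv (fun q => light (f q)) p Y) = 0 := by
      have e4 : lorentz (vderiv (s ∘ π) p Y) (light (f p)) +
        lorentz ((s ∘ π) p) (vderiv (fun q => light (f q)) p Y) = 0 := e1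
      rwa [e2, zero_add] at e4
    rw [lorentz_add_right, lorentz_smul_right, hsl, e3, mul_zero, add_zero]
  · obtain ⟨W, hW, hW'⟩ := h.exists_sphere u
    exact ⟨W, hW, fun p hp => hW' p.1 hp⟩
  · intro Z Z' hZ
    rw [← hJd b u Z, hZ, hJd]
  · obtain ⟨B, hB⟩ := exists_tangent_operator (h.immersion b) u (h.vderiv_mem b u)
    refine ⟨(mfderiv (𝓡 m) (𝓡 (n - 1)) (J b) u).toLinearMap ∘ₗ B ∘ₗ
      (mfderiv (𝓡 (n - 1)) (𝓡 m) π (J b u)).toLinearMap, fun Y => ?_, fun Z => ⟨B Z, ?_⟩⟩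
    · have e1 : ∀ Z, vderiv (fun q => light (f q)) (J b u) (mfderiv (𝓡 m) (𝓡 (n - 1)) (J b) u Z) =
          vderiv (fun v => light (X b v)) u Z := by
        intro Z
        refine (vderiv_comp ((hls _).mdifferentiableAt (by simp))
          ((hJs b u).mdifferentiableAt (by simp)) Z).symm.trans ?_
        exact vderiv_congr (Filter.Eventually.of_forall fun v => congrArg light (hfX b v)) Z
      rw [hνd, hfX b u]
      refine (congrArg (· ∈ Submodule.span ℝ {light (X b u)})
        (congrArg (vderiv s u (mfderiv (𝓡 (n - 1)) (𝓡 m) π (J b u) Y) + ·) (e1 _))).mpr ?_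
      exact hB _
    · change mfderiv (𝓡 m) (𝓡 (n - 1)) (J b) u (B (mfderiv (𝓡 (n - 1)) (𝓡 m) π (J b u)
        (mfderiv (𝓡 m) (𝓡 (n - 1)) (J b) u Z))) = _
      rw [hJd]

section Pair

variable {m n : ℕ} {P : Type*} [TopologicalSpace P] [ChartedSpace (EuclideanSpace ℝ (Fin m)) P]

/-- The hyperspheres of a parallel unit normal field of `x` that pass through the points of `x'`
form a family that is orthogonal to any sphere congruence enveloped by `x` and `x'`. -/
lemma exists_isEnvelopedPair {x x' : P → Sph n} {t : P → LorentzSpace n}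
    (hx : IsSphImmersion (k := m) x) (hx' : IsSphImmersion (k := m) x')
    (hne : ∀ u, x u ≠ x' u) (henv : EnvelopSphereCongruence (k := m) x x')
    (ht : IsParallelUnitNormalField (k := m) x t) :
    ∃ (C : P → Submodule ℝ (LorentzSpace n)) (s : P → LorentzSpace n),
      (∀ u, s u - t u ∈ Submodule.span ℝ {light (x u)}) ∧
      IsEnvelopedPair (m := m) (fun b => bif b then x else x') C s := by
  obtain ⟨C, hC, hd⟩ := henv
  have hlx := hx.contMDiff_light
  have hlx' := hx'.contMDiff_light
  let a : P → ℝ := fun u => lorentz (t u) (light (x' u)) * (lorentz (light (x u)) (light (x' u)))⁻¹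
  let s : P → LorentzSpace n := fun u => t u - a u • light (x u)
  have ha : ContMDiff (𝓡 m) 𝓘(ℝ, ℝ) ∞ a :=
    (contMDiff_lorentz ht.1.smooth hlx').mul
      ((contMDiff_lorentz hlx hlx').inv₀ fun u => lorentz_light_ne (hne u))
  have hs : ContMDiff (𝓡 m) 𝓘(ℝ, LorentzSpace n) ∞ s := ht.1.smooth.sub (ha.smul hlx)
  have hsD : ∀ u, ∀ w ∈ derived (k := m) x u, lorentz (s u) w = 0 := by
    intro u w hw
    rw [lorentz_sub_left, lorentz_smul_left, ht.1.normal u w hw, lorentz_light_derived hx.1 hw]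
    simp
  have hsx' : ∀ u, lorentz (s u) (light (x' u)) = 0 := by
    intro u
    rw [lorentz_sub_left, lorentz_smul_left]
    simp only [a]
    rw [mul_assoc, inv_mul_cancel₀ (lorentz_light_ne (hne u)), mul_one, sub_self]
  have hxC' : ∀ u, light (x' u) ∈ C u := fun u => (hd u).2 (light_mem_derived _ _)
  have hxC : ∀ u, light (x u) ∈ C u := fun u => (hd u).1 (light_mem_derived _ _)
  have hsC : ∀ u, ∀ w ∈ C u, lorentz (s u) w = 0 := by
    intro u w hw
    rw [(hC.1 u).eq_derived_sup hx (hne u) (hd u).1 (hxC' u), Submodule.mem_sup] at hw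
    obtain ⟨y, hy, z, hz, rfl⟩ := hw
    obtain ⟨c, rfl⟩ := Submodule.mem_span_singleton.1 hz
    rw [lorentz_add_right, hsD u y hy, lorentz_smul_right, hsx' u]
    simp
  have hds : ∀ u (Z : TangentSpace (𝓡 m) u), vderiv s u Z ∈ derived (k := m) x u := by
    intro u Z
    obtain ⟨c, hc⟩ : ∃ c : ℝ, mfderiv (𝓡 m) 𝓘(ℝ, ℝ) a u Z = c := ⟨_, rfl⟩
    have e1 := vderiv_sub ((ht.1.smooth u).mdifferentiableAt (by simp))
      (((ha.smul hlx) u).mdifferentiableAt (by simp)) Z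
    have e2 := vderiv_smul ((ha u).mdifferentiableAt (by simp))
      ((hlx u).mdifferentiableAt (by simp)) Z hc
    have e3 : vderiv s u Z = vderiv t u Z -
        (a u • vderiv (fun q => light (x q)) u Z + c • light (x u)) :=
      e1.trans (congrArg (vderiv t u Z - ·) e2)
    rw [e3]
    refine Submodule.sub_mem _ ((Submodule.Quotient.mk_eq_zero _).1 (ht.2 u Z))
      (Submodule.add_mem _ (Submodule.smul_mem _ _ (vderiv_mem_derived x u Z))
        (Submodule.smul_mem _ _ (light_mem_derived x u)))
  have hds' : ∀ u (Z : TangentSpace (𝓡 m) u), vderiv s u Z ∈ derived (k := m) x' u := by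
    intro u Z
    refine (hC.1 u).mem_derived hx' (hne u).symm (hd u).2 (hxC u) ((hd u).1 (hds u Z)) ?_
    have e1 := lorentz_vderiv_add_eq_zero ((hs u).mdifferentiableAt (by simp))
      ((hlx' u).mdifferentiableAt (by simp)) (Filter.Eventually.of_forall hsx') Z
    rw [hsC u _ ((hd u).2 (vderiv_mem_derived x' u Z)), add_zero] at e1
    exact (lorentz_comm _ _).trans e1
  refine ⟨C, s, fun u => ?_, ⟨?_, ?_, hC, ?_, ⟨hs, fun u => ?_⟩, hsC, ?_⟩⟩
  · rw [show s u - t u = (-a u) • light (x u) by simp [s]]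
    exact Submodule.smul_mem _ _ (Submodule.mem_span_singleton_self _)
  · rintro (_ | _)
    exacts [hx', hx]
  · rintro (_ | _) u
    exacts [(hne u).symm, hne u]
  · rintro (_ | _) u
    exacts [(hd u).2, (hd u).1]
  · have e1 : lorentz (t u) (light (x u)) = 0 := ht.1.normal u _ (light_mem_derived x u)
    simp only [s, lorentz_sub_left, lorentz_sub_right, lorentz_smul_left, lorentz_smul_right,
      lorentz_light_self, ht.1.unit u, e1, lorentz_comm (light (x u)) (t u)]
    simp
  · rintro (_ | _)
    exacts [hds', hds]

end Pair

end ConformalSubmanifold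

open ConformalSubmanifold
theorem mainTheorem8 (m n : ℕ)
    (P : Type u) [TopologicalSpace P] [T2Space P] [SecondCountableTopology P]
    [ChartedSpace (EuclideanSpace ℝ (Fin m)) P] [IsManifold (𝓡 m) ∞ P] :
    (∀ (x x' : P → Sph n) (t : P → LorentzSpace n),
      IsSphImmersion (k := m) x → IsSphImmersion (k := m) x' → (∀ u, x u ≠ x' u) →
      EnvelopSphereCongruence (k := m) x x' →
      IsParallelUnitNormalField (k := m) x t →
      ∃ (M : Type u) (_ : TopologicalSpace M) (_ : T2Space M) (_ : SecondCountableTopology M)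
        (_ : ChartedSpace (EuclideanSpace ℝ (Fin (n - 1))) M) (_ : IsManifold (𝓡 (n - 1)) ∞ M)
        (s : P → LorentzSpace n) (f : M → Sph n) (π : M → P) (j j' : P → M),
        IsHypersphereFamily (k := m) s ∧
        (∀ u, s u - t u ∈ Submodule.span ℝ {light (x u)}) ∧
        (∀ (u : P) (X : TangentSpace (𝓡 m) u), vderiv s u X ≠ 0 →
          0 < lorentz (vderiv s u X) (vderiv s u X)) ∧
        IsEnvelope (m := m) s f π ∧
        (∀ u, ∃ C : Submodule ℝ (LorentzSpace n), IsSphere (n - m - 1) C ∧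
          ∀ p, π p = u → light (f p) ∈ C) ∧
        (∀ u, π (j u) = u) ∧ (∀ u, π (j' u) = u) ∧
        (∀ u, f (j u) = x u) ∧ (∀ u, f (j' u) = x' u) ∧
        IsExtendedCurvatureLeaf (m := m) f (s ∘ π) j ∧
        IsExtendedCurvatureLeaf (m := m) f (s ∘ π) j') ∧
    (m + 1 < n →
      ∀ (M : Type v) [TopologicalSpace M] [ChartedSpace (EuclideanSpace ℝ (Fin (n - 1))) M]
        [IsManifold (𝓡 (n - 1)) ∞ M]
        (L : Type w) [TopologicalSpace L] [ChartedSpace (EuclideanSpace ℝ (Fin m)) L]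
        [IsManifold (𝓡 m) ∞ L]
        (s : P → LorentzSpace n) (f : M → Sph n) (π : M → P) (j j' : L → M),
        IsHypersphereFamily (k := m) s → IsSpacelikeImmersion (k := m) s →
        IsEnvelope (m := m) s f π →
        IsExtendedCurvatureLeaf (m := m) f (s ∘ π) j →
        IsExtendedCurvatureLeaf (m := m) f (s ∘ π) j' →
        IsComplementaryLeaf m n π j → IsComplementaryLeaf m n π j' →
        (∀ u, π (j u) = π (j' u)) → (∀ u, f (j u) ≠ f (j' u)) →
        EnvelopSphereCongruence (k := m) (fun u => f (j u)) (fun u => f (j' u))) := by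
  refine ⟨fun x x' t hx hx' hne henv ht => ?_, fun _ M _ _ _ L _ _ _ s f π j j' hs hsp he hj hj' hc
    hc' hπ hne => envelopSphereCongruence_of_leaves hs hsp he hj hj' hc hc' hπ hne⟩
  obtain ⟨C, s, hst, h⟩ := exists_isEnvelopedPair hx hx' hne henv ht
  obtain ⟨M, i₁, i₂, i₃, i₄, i₅, f, π, J, hf, hsph, hJ⟩ := h.exists_envelope
  refine ⟨M, i₁, i₂, i₃, i₄, i₅, s, f, π, J true, J false, h.family, hst, fun u Z hZ => ?_, hf, hsph,
    (hJ true).1, (hJ false).1, (hJ true).2.1, (hJ false).2.1, (hJ true).2.2, (hJ false).2.2⟩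
  exact lorentz_self_pos_of_orthogonal (hne u)
    ((lorentz_comm _ _).trans (h.lorentz_vderiv_family true u Z))
    ((lorentz_comm _ _).trans (h.lorentz_vderiv_family false u Z)) hZ
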